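/- Let $F$ be a local field, $D$ a central division algebra over $F$ of finite dimension $d^2$, $n\ge 1$ an integer, and $G=\mathrm{GL}_n(D)$. Let $\mathcal S$ be the space of Schwartz functions (if $F$ is archimedean) or Bruhat–Schwartz functions (if $F$ is non-archimedean) on the matrix space $\mathrm M_n(D)$, viewed as a representation of $G\times G$ by $$((g,h).\phi)(x)=|\det(g^{-1}h)|_F^{\frac{dn}{2}}\,\phi(g^{-1}xh),\qquad g,h\in G,\ \phi\in\mathcal S,\ x\in \mathrm M_n(D),$$ where $\det$ is the reduced norm on $\mathrm M_n(D)$ and $|\cdot|_F$ is the normalized absolute value on $F$. Put $G_1=G\times\{1\}$ and $G_2=\{1\}\times G$, both identified with $G$. Let $\sigma$ be an irreducible admissible smooth representation of $G$, that is, an irreducible Casselman–Wallach representation if $F$ is archimedean, and an irreducible smooth representation (of finite length) if $F$ is non-archimedean; let $\sigma^\vee$ be its contragredient. For $i=1,2$ view $\sigma^\vee$ as a representation of $G_i$ and put $$\Theta_i(\sigma)=(\mathcal S\,\widehat\otimes\,\sigma^\vee)_{G_i},$$ where $\widehat\otimes$ is the completed projective tensor product in the archimedean case and the algebraic tensor product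 in the non-archimedean case, and the subscript $G_i$ denotes the maximal (Hausdorff, in the archimedean case) quotient on which $G_i$ acts trivially. The group $G$ acts on $\Theta_1(\sigma)$ through $G_2\cong G$, and on $\Theta_2(\sigma)$ through $G_1\cong G$. Then $\Theta_1(\sigma)$ and $\Theta_2(\sigma)$ are isomorphic as representations of $G$; that is, there is a $G$-equivariant linear isomorphism $\Theta_1(\sigma)\cong\Theta_2(\sigma)$, which is a homeomorphism in the archimedean case. -/

import Mathlib

open scoped TensorProduct

noncomputable section

namespace FullTheta

universe u v w

/-! ### Normalized absolute value, reduced norm, and the group `GL_n(D)` -/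

/-- The normalized absolute value on a locally compact field: `|0| = 0`, and for `x ≠ 0` the number
`|x|` is the factor by which multiplication by `x` scales an additive Haar measure. It is the usual
absolute value on `ℝ`, the square of the usual one on `ℂ`, and sends a uniformizer to `q⁻¹` in the
non-archimedean case with residue field of cardinality `q`. -/
def normalizedAbs {F : Type*} [Field F] [TopologicalSpace F] [IsTopologicalRing F]
    [LocallyCompactSpace F] (x : F) : ℝ :=
  open Classical in
  if hx : x = 0 then 0 else (MeasureTheory.distribHaarChar F (Units.mk0 x hx) : ℝ)

/-- `c` is the reduced norm of the element `a` of the central simple `F`-algebra `A`: it is the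
determinant of the image of `a` under an algebra homomorphism from `A` to a matrix algebra of size
`m = √(dim A)` over an algebraic closure of `F`. For dimension reasons such a homomorphism is the
same as a splitting `A ⊗ F̄ ≃ M_m(F̄)`; the determinant does not depend on it, and lies in `F`. -/
def IsReducedNorm (F : Type*) {A : Type*} [Field F] [Ring A] [Algebra F A] (a : A) (c : F) : Prop :=
  ∃ (m : ℕ) (φ : A →ₐ[F] Matrix (Fin m) (Fin m) (AlgebraicClosure F)),
    m ^ 2 = Module.finrank F A ∧ (φ a).det = algebraMap F (AlgebraicClosure F) c

/-- The reduced norm of a finite dimensional central simple algebra `A` over `F`. -/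
def reducedNorm (F : Type*) {A : Type*} [Field F] [Ring A] [Algebra F A] (a : A) : F :=
  open Classical in
  if h : ∃ c : F, IsReducedNorm F a c then h.choose else 0

/-- The group `G = GL_n(D)` of invertible `n × n` matrices over the division ring `D`. -/
abbrev GLn (n : ℕ) (D : Type*) [Ring D] : Type _ := (Matrix (Fin n) (Fin n) D)ˣ

/-- The factor `|det (g⁻¹ h)|_F ^ (d n / 2)`, where `det` is the reduced norm of `M_n(D)`. -/
def detFactor (F : Type*) {D : Type*} [Field F] [TopologicalSpace F] [IsTopologicalRing F]
    [LocallyCompactSpace F] [Ring D] [Algebra F D] (d : ℕ) {n : ℕ} (g h : GLn n D) : ℝ :=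
  normalizedAbs (reducedNorm F ((g⁻¹ * h : GLn n D) : Matrix (Fin n) (Fin n) D)) ^
    ((d : ℝ) * (n : ℝ) / 2)

/-! ### The non-archimedean case -/

/-- Bruhat-Schwartz functions: locally constant complex functions with compact support. -/
def BruhatSchwartz (X : Type*) [TopologicalSpace X] : Submodule ℂ (X → ℂ) where
  carrier := {f | IsLocallyConstant f ∧ HasCompactSupport f}
  add_mem' := fun hf hg => ⟨hf.1.add hg.1, hf.2.add hg.2⟩
  zero_mem' := ⟨IsLocallyConstant.const 0, HasCompactSupport.zero⟩
  smul_mem' := fun c f hf => ⟨hf.1.comp (fun z => c * z), hf.2.comp_left (g := fun z => c * z) (by simp)⟩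

section NonArch

variable {D : Type*} [Ring D] [TopologicalSpace D] [IsTopologicalRing D] {n : ℕ}

/-- The homeomorphism `x ↦ g⁻¹ x h` of `M_n(D)`. -/
def transHomeo (g h : GLn n D) :
    Matrix (Fin n) (Fin n) D ≃ₜ Matrix (Fin n) (Fin n) D where
  toFun x := (g⁻¹ : GLn n D) * x * h
  invFun x := g * x * (h⁻¹ : GLn n D)
  left_inv x := by simp [mul_assoc]
  right_inv x := by simp [mul_assoc]
  continuous_toFun := by fun_prop
  continuous_invFun := by fun_prop

/-- The action `((g,h).φ)(x) = |det (g⁻¹ h)|^(d n / 2) φ(g⁻¹ x h)` of `G × G` on the space `𝒮` of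
Bruhat-Schwartz functions on `M_n(D)`. -/
def bsAct (F : Type*) [Field F] [TopologicalSpace F] [IsTopologicalRing F] [LocallyCompactSpace F]
    [Algebra F D] (d : ℕ) (g h : GLn n D) :
    BruhatSchwartz (Matrix (Fin n) (Fin n) D) →ₗ[ℂ] BruhatSchwartz (Matrix (Fin n) (Fin n) D) where
  toFun φ := ((detFactor F d g h : ℝ) : ℂ) •
    ⟨fun x => φ.1 ((g⁻¹ : GLn n D) * x * h),
      φ.2.1.comp_continuous (transHomeo g h).continuous,
      φ.2.2.comp_homeomorph (transHomeo g h)⟩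
  map_add' φ ψ := by ext x; simp
  map_smul' c φ := by ext x; simp [mul_left_comm]

end NonArch

section SmoothReps

variable {G : Type*} [Group G] [TopologicalSpace G]
  {V : Type*} [AddCommGroup V] [Module ℂ V]

/-- A representation is smooth if every vector has an open stabilizer. -/
def IsSmoothRep (σ : Representation ℂ G V) : Prop :=
  ∀ x : V, IsOpen {g : G | σ g x = x}

/-- Non-archimedean admissible smooth representations: smooth representations of finite length. -/
structure IsAdmissibleSmooth (σ : Representation ℂ G V) : Prop where
  smooth : IsSmoothRep σ
  finiteLength : IsFiniteLength (MonoidAlgebra ℂ G) σ.asModule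

/-- The smooth vectors of the algebraic dual of a representation. -/
def smoothDual [ContinuousMul G] (σ : Representation ℂ G V) :
    Subrepresentation σ.dual where
  toSubmodule :=
    { carrier := {l | ∃ U : Subgroup G, IsOpen (U : Set G) ∧ ∀ g ∈ U, σ.dual g l = l}
      zero_mem' := ⟨⊤, isOpen_univ, fun g _ => map_zero _⟩
      add_mem' := by
        rintro l m ⟨U, hU, hl⟩ ⟨W, hW, hm⟩
        refine ⟨U ⊓ W, hU.inter hW, fun g hg => ?_⟩
        rw [map_add, hl g hg.1, hm g hg.2]
      smul_mem' := by
        rintro c l ⟨U, hU, hl⟩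
        exact ⟨U, hU, fun g hg => by rw [map_smul, hl g hg]⟩ }
  apply_mem_toSubmodule := by
    rintro a l ⟨U, hU, hl⟩
    refine ⟨U.comap (MulAut.conj a⁻¹).toMonoidHom, ?_, fun g hg => ?_⟩
    · refine hU.preimage (f := fun g : G => a⁻¹ * g * a⁻¹⁻¹) ?_
      fun_prop
    · have h1 := hl _ hg
      have h2 : g * a = a * (a⁻¹ * g * a⁻¹⁻¹) := by group
      calc σ.dual g (σ.dual a l) = σ.dual (g * a) l := by rw [map_mul]; rfl
        _ = σ.dual a (σ.dual (a⁻¹ * g * a⁻¹⁻¹) l) := by rw [h2, map_mul]; rfl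
        _ = σ.dual a l := congrArg _ h1

/-- The contragredient representation `σ^∨` of a smooth representation `σ`. -/
abbrev contragredient [ContinuousMul G] (σ : Representation ℂ G V) :
    Representation ℂ G (smoothDual σ).toSubmodule :=
  (smoothDual σ).toRepresentation

end SmoothReps

section Coinvariants

variable {G : Type*} {W : Type*} [AddCommGroup W] [Module ℂ W]

/-- The span of all vectors `g.x - x`, where `g` acts by the operator `T g`. -/
def coinvariantsKer (T : G → W →ₗ[ℂ] W) : Submodule ℂ W :=
  Submodule.span ℂ {y | ∃ (g : G) (x : W), y = T g x - x}

/-- The coinvariants: the maximal quotient on which the operators `T g` act trivially. -/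
abbrev Coinvariants (T : G → W →ₗ[ℂ] W) : Type _ := W ⧸ coinvariantsKer T

theorem coinvariantsKer_le_comap (T : G → W →ₗ[ℂ] W) (A : W →ₗ[ℂ] W)
    (hA : ∀ g x, A (T g x) = T g (A x)) :
    coinvariantsKer T ≤ (coinvariantsKer T).comap A := by
  refine Submodule.span_le.2 ?_
  rintro _ ⟨g, x, rfl⟩
  refine Submodule.subset_span ⟨g, A x, ?_⟩
  rw [map_sub, hA]

end Coinvariants

section NonArchTheta

variable (F : Type*) [Field F] [TopologicalSpace F] [IsTopologicalRing F] [LocallyCompactSpace F]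
  {D : Type*} [Ring D] [TopologicalSpace D] [IsTopologicalRing D] [Algebra F D] (d : ℕ) {n : ℕ}
  {V : Type*} [AddCommGroup V] [Module ℂ V] (σ : Representation ℂ (GLn n D) V)

theorem bsAct_comm (g h : GLn n D) (φ : BruhatSchwartz (Matrix (Fin n) (Fin n) D)) :
    bsAct F d 1 h (bsAct F d g 1 φ) = bsAct F d g 1 (bsAct F d 1 h φ) := by
  ext x
  simp [bsAct, mul_assoc, mul_left_comm]

/-- The space `𝒮 ⊗ σ^∨`. -/
abbrev BSTensor : Type _ :=
  BruhatSchwartz (Matrix (Fin n) (Fin n) D) ⊗[ℂ] (smoothDual σ).toSubmodule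

/-- The diagonal action of `g` on `𝒮 ⊗ σ^∨`, where `σ^∨` is viewed as a representation of
`G₁ = G × {1}`. -/
def diagAct₁ (g : GLn n D) : BSTensor σ →ₗ[ℂ] BSTensor σ :=
  TensorProduct.map (bsAct F d g 1) (contragredient σ g)

/-- The diagonal action of `g` on `𝒮 ⊗ σ^∨`, where `σ^∨` is viewed as a representation of
`G₂ = {1} × G`. -/
def diagAct₂ (g : GLn n D) : BSTensor σ →ₗ[ℂ] BSTensor σ :=
  TensorProduct.map (bsAct F d 1 g) (contragredient σ g)

/-- The full theta lift `Θ₁(σ) = (𝒮 ⊗ σ^∨)_{G₁}`. -/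
abbrev Theta₁ : Type _ := Coinvariants (W := BSTensor σ) (diagAct₁ F d σ)

/-- The full theta lift `Θ₂(σ) = (𝒮 ⊗ σ^∨)_{G₂}`. -/
abbrev Theta₂ : Type _ := Coinvariants (W := BSTensor σ) (diagAct₂ F d σ)

/-- The action of `h ∈ G ≅ G₂` on `Θ₁(σ)`, through its action on `𝒮`. -/
def theta₁Act (h : GLn n D) : Theta₁ F d σ →ₗ[ℂ] Theta₁ F d σ :=
  Submodule.mapQ _ _ (TensorProduct.map (bsAct F d 1 h) LinearMap.id) <|
    coinvariantsKer_le_comap _ _ fun g x => by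
      induction x using TensorProduct.induction_on with
      | zero => simp
      | add x y hx hy => simp only [map_add, hx, hy]
      | tmul φ l => simp [diagAct₁, bsAct_comm]

/-- The action of `g ∈ G ≅ G₁` on `Θ₂(σ)`, through its action on `𝒮`. -/
def theta₂Act (g : GLn n D) : Theta₂ F d σ →ₗ[ℂ] Theta₂ F d σ :=
  Submodule.mapQ _ _ (TensorProduct.map (bsAct F d g 1) LinearMap.id) <|
    coinvariantsKer_le_comap _ _ fun h x => by
      induction x using TensorProduct.induction_on with
      | zero => simp
      | add x y hx hy => simp only [map_add, hx, hy]
      | tmul φ l => simp [diagAct₂, bsAct_comm]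

end NonArchTheta

/-! ### Completed projective tensor products -/

section Projective

variable (E : Type*) [AddCommGroup E] [Module ℂ E] [TopologicalSpace E]
  (H : Type*) [AddCommGroup H] [Module ℂ H] [TopologicalSpace H]

/-- The algebraic tensor product of two topological vector spaces, to be given the projective
topology. -/
def ProjTensor : Type _ := E ⊗[ℂ] H

instance : AddCommGroup (ProjTensor E H) := inferInstanceAs (AddCommGroup (E ⊗[ℂ] H))

instance : Module ℂ (ProjTensor E H) := inferInstanceAs (Module ℂ (E ⊗[ℂ] H))

/-- Locally convex vector space topologies on `E ⊗ H` for which `(x, y) ↦ x ⊗ y` is continuous. -/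
structure IsTensorTopology (t : TopologicalSpace (ProjTensor E H)) : Prop where
  addGroup : IsTopologicalAddGroup (ProjTensor E H)
  smul : ContinuousSMul ℂ (ProjTensor E H)
  locallyConvex : LocallyConvexSpace ℝ (ProjTensor E H)
  continuous_tmul :
    Continuous (fun p : E × H => (show ProjTensor E H from p.1 ⊗ₜ[ℂ] p.2))

/-- The projective topology: the finest locally convex topology on `E ⊗ H` for which the canonical
bilinear map `E × H → E ⊗ H` is continuous. -/
instance : TopologicalSpace (ProjTensor E H) := sInf {t | IsTensorTopology E H t}

instance : IsTopologicalAddGroup (ProjTensor E H) :=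
  topologicalAddGroup_sInf fun _ ht => ht.addGroup

instance : ContinuousSMul ℂ (ProjTensor E H) :=
  continuousSMul_sInf fun _ ht => ht.smul

theorem isTensorTopology_projTensor :
    IsTensorTopology E H (inferInstanceAs (TopologicalSpace (ProjTensor E H))) where
  addGroup := inferInstance
  smul := inferInstance
  locallyConvex := LocallyConvexSpace.sInf fun _ ht => ht.locallyConvex
  continuous_tmul := continuous_sInf_rng.2 fun _ ht => ht.continuous_tmul

instance : UniformSpace (ProjTensor E H) := IsTopologicalAddGroup.rightUniformSpace _

instance : IsUniformAddGroup (ProjTensor E H) := isUniformAddGroup_of_addCommGroup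

instance : UniformContinuousConstSMul ℂ (ProjTensor E H) :=
  uniformContinuousConstSMul_of_continuousConstSMul ℂ _

/-- The completed projective tensor product `E ⊗̂ H`. -/
abbrev CompletedTensor : Type _ := UniformSpace.Completion (ProjTensor E H)

variable {E H}

/-- The tensor product of two continuous linear maps, continuous for the projective topology. -/
def projMap (A : E →L[ℂ] E) (B : H →L[ℂ] H) : ProjTensor E H →L[ℂ] ProjTensor E H where
  toLinearMap := (TensorProduct.map A.toLinearMap B.toLinearMap : E ⊗[ℂ] H →ₗ[ℂ] E ⊗[ℂ] H)
  cont := by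
    refine continuous_sInf_rng.2 fun t ht => ?_
    let f : ProjTensor E H →ₗ[ℂ] ProjTensor E H :=
      (TensorProduct.map A.toLinearMap B.toLinearMap : E ⊗[ℂ] H →ₗ[ℂ] E ⊗[ℂ] H)
    refine continuous_sInf_dom (t₁ := {t | IsTensorTopology E H t}) (t := t.induced f) ?_
      continuous_induced_dom
    have h1 := ht.addGroup
    have h2 := ht.smul
    have h3 := ht.locallyConvex
    refine @IsTensorTopology.mk E _ _ _ H _ _ _ (t.induced f) ?_ ?_ ?_ ?_
    · exact topologicalAddGroup_induced f
    · exact continuousSMul_induced f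
    · exact LocallyConvexSpace.induced (𝕜 := ℝ) (f.restrictScalars ℝ)
    · refine continuous_induced_rng.2 ?_
      exact ht.continuous_tmul.comp (A.continuous.prodMap B.continuous)

/-- The map `A ⊗̂ B` of completed projective tensor products. -/
def completedMap (A : E →L[ℂ] E) (B : H →L[ℂ] H) : CompletedTensor E H →L[ℂ] CompletedTensor E H :=
  (projMap A B).completion

theorem completedMap_comm (A A' : E →L[ℂ] E) (B B' : H →L[ℂ] H)
    (hA : ∀ x, A (A' x) = A' (A x)) (hB : ∀ x, B (B' x) = B' (B x)) (z : CompletedTensor E H) :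
    completedMap A B (completedMap A' B' z) = completedMap A' B' (completedMap A B z) := by
  induction z using UniformSpace.Completion.induction_on with
  | hp =>
    exact isClosed_eq ((completedMap A B).continuous.comp (completedMap A' B').continuous)
      ((completedMap A' B').continuous.comp (completedMap A B).continuous)
  | ih z =>
    simp only [completedMap, ContinuousLinearMap.completion_apply_coe]
    congr 1
    change TensorProduct.map A.toLinearMap B.toLinearMap
        (TensorProduct.map A'.toLinearMap B'.toLinearMap z) =
      TensorProduct.map A'.toLinearMap B'.toLinearMap
        (TensorProduct.map A.toLinearMap B.toLinearMap z)
    induction z using TensorProduct.induction_on with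
    | zero => simp
    | add x y hx hy => simp only [map_add, hx, hy]
    | tmul x y => simp [hA, hB]

end Projective

section HausdorffCoinvariants

variable {G : Type*} {W : Type*} [AddCommGroup W] [Module ℂ W] [TopologicalSpace W]
  [IsTopologicalAddGroup W] [ContinuousConstSMul ℂ W]

/-- The closed span of all vectors `g.x - x`, where `g` acts by the operator `T g`. -/
def closedCoinvariantsKer (T : G → W →L[ℂ] W) : Submodule ℂ W :=
  (coinvariantsKer fun g => (T g).toLinearMap).topologicalClosure

/-- The Hausdorff coinvariants: the maximal Hausdorff quotient on which the operators `T g` act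
trivially, with its quotient topology. -/
abbrev HausdorffCoinvariants (T : G → W →L[ℂ] W) : Type _ := W ⧸ closedCoinvariantsKer T

theorem closedCoinvariantsKer_le_comap (T : G → W →L[ℂ] W) (A : W →L[ℂ] W)
    (hA : ∀ g x, A (T g x) = T g (A x)) :
    closedCoinvariantsKer T ≤ (closedCoinvariantsKer T).comap A.toLinearMap := by
  refine Submodule.topologicalClosure_minimal _ ?_ ?_
  · exact (coinvariantsKer_le_comap _ A.toLinearMap hA).trans
      (Submodule.comap_mono (Submodule.le_topologicalClosure _))
  · exact (Submodule.isClosed_topologicalClosure _).preimage A.continuous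

end HausdorffCoinvariants

/-! ### Casselman-Wallach representations -/

section CasselmanWallach

/-- Maps of class `C^k` on an open subset `U` of a normed space `E` with values in a topological
vector space `V` (Michal-Bastiani calculus): `f` is `C^0` if it is continuous, and it is `C^(k+1)`
if it is continuous and its directional derivatives exist and form a `C^k` map on `U × E`. -/
def IsCk {V : Type v} [AddCommGroup V] [Module ℝ V] [TopologicalSpace V] :
    ℕ → ∀ (E : Type u) [NormedAddCommGroup E] [NormedSpace ℝ E], Set E → (E → V) → Prop
  | 0, _, _, _, U, f => ContinuousOn f U
  | k + 1, E, _, _, U, f => ContinuousOn f U ∧ ∃ f' : E × E → V,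
      (∀ x ∈ U, ∀ y : E, Filter.Tendsto (fun t : ℝ => t⁻¹ • (f (x + t • y) - f x))
        (nhdsWithin 0 {0}ᶜ) (nhds (f' (x, y)))) ∧
      IsCk k (E × E) (U ×ˢ Set.univ) f'

/-- Fréchet spaces: complete metrizable locally convex Hausdorff topological vector spaces. -/
structure IsFrechet (V : Type*) [AddCommGroup V] [Module ℂ V] [UniformSpace V] : Prop where
  isUniformAddGroup : IsUniformAddGroup V
  continuousSMul : ContinuousSMul ℂ V
  locallyConvex : LocallyConvexSpace ℝ V
  t2 : T2Space V
  firstCountable : FirstCountableTopology V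
  complete : CompleteSpace V

attribute [local instance] Matrix.normedAddCommGroup Matrix.normedSpace

variable {D : Type u} [NormedDivisionRing D] [NormedAlgebra ℝ D] {n : ℕ}
  {V : Type v} [AddCommGroup V] [Module ℂ V] [UniformSpace V]
  {W : Type w} [AddCommGroup W] [Module ℂ W] [UniformSpace W]

/-- The orbit map `g ↦ g.x` of a vector `x`, extended by zero from `GL_n(D)` to `M_n(D)`. -/
def orbitMap (σ : Representation ℂ (GLn n D) V) (x : V) (a : Matrix (Fin n) (Fin n) D) : V :=
  open Classical in if ha : IsUnit a then σ ha.unit x else 0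

/-- Closed subspaces stable under the group action. -/
def IsClosedSubrep (σ : Representation ℂ (GLn n D) V) (U : Submodule ℂ V) : Prop :=
  IsClosed (U : Set V) ∧ ∀ g, ∀ x ∈ U, σ g x ∈ U

/-- `K` is a maximal compact subgroup of `GL_n(D)`. -/
def IsMaximalCompact (K : Subgroup (GLn n D)) : Prop :=
  IsCompact (K : Set (GLn n D)) ∧
    ∀ K' : Subgroup (GLn n D), IsCompact (K' : Set (GLn n D)) → K ≤ K' → K' = K

/-- Casselman-Wallach representations of `GL_n(D)`, for `D` a finite dimensional division algebra
over `ℝ`: smooth Fréchet representations of moderate growth which are admissible (every irreducible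
representation of a maximal compact subgroup occurs with finite multiplicity) and of finite length
(the lengths of chains of closed subrepresentations are bounded). -/
structure IsCasselmanWallach (σ : Representation ℂ (GLn n D) V) : Prop where
  frechet : IsFrechet V
  continuous_action : Continuous fun p : GLn n D × V => σ p.1 p.2
  smooth : ∀ (x : V) (k : ℕ),
    IsCk k (Matrix (Fin n) (Fin n) D) {a | IsUnit a} (orbitMap σ x)
  moderateGrowth : ∀ p : Seminorm ℂ V, Continuous p →
    ∃ (q : Seminorm ℂ V) (N : ℕ), Continuous q ∧ ∀ (g : GLn n D) (x : V),
      p (σ g x) ≤ (1 + ‖(g : Matrix (Fin n) (Fin n) D)‖ +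
        ‖((g⁻¹ : GLn n D) : Matrix (Fin n) (Fin n) D)‖) ^ N * q x
  admissible : ∀ K : Subgroup (GLn n D), IsMaximalCompact K →
    ∀ (m : ℕ) (ρ : Representation ℂ K (Fin m → ℂ)), (∀ x, Continuous fun k => ρ k x) →
      ρ.IsIrreducible → FiniteDimensional ℂ (ρ.IntertwiningMap (σ.comp K.subtype))
  finiteLength : ∃ N : ℕ, ∀ l : LTSeries {U : Submodule ℂ V // IsClosedSubrep σ U}, l.length ≤ N

/-- Topological irreducibility. -/
def IsTopIrreducible (σ : Representation ℂ (GLn n D) V) : Prop :=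
  Nontrivial V ∧ ∀ U : Submodule ℂ V, IsClosedSubrep σ U → U = ⊥ ∨ U = ⊤

/-- The representation `τ` is the contragredient of the Casselman-Wallach representation `σ`: it is
a Casselman-Wallach representation which has a continuous, `G`-invariant, non-degenerate pairing
with `σ`. This determines `τ` up to isomorphism, its space of `K`-finite vectors being the
`K`-finite dual of that of `σ`. -/
structure IsContragredient (σ : Representation ℂ (GLn n D) V) (τ : Representation ℂ (GLn n D) W) :
    Prop where
  casselmanWallach : IsCasselmanWallach τ
  pairing : ∃ B : V →ₗ[ℂ] W →ₗ[ℂ] ℂ, (Continuous fun p : V × W => B p.1 p.2) ∧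
    (∀ g x y, B (σ g x) (τ g y) = B x y) ∧
    (∀ x, (∀ y, B x y = 0) → x = 0) ∧ (∀ y, (∀ x, B x y = 0) → y = 0)

theorem IsCasselmanWallach.continuous_apply {σ : Representation ℂ (GLn n D) V}
    (hσ : IsCasselmanWallach σ) (g : GLn n D) : Continuous (σ g) :=
  hσ.continuous_action.comp (Continuous.prodMk_right g)

end CasselmanWallach

/-! ### Theta lifts in the archimedean case -/

section ArchTheta

attribute [local instance] Matrix.normedAddCommGroup Matrix.normedSpace

variable (F : Type*) [Field F] [TopologicalSpace F] [IsTopologicalRing F] [LocallyCompactSpace F]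
  {D : Type*} [NormedDivisionRing D] [NormedAlgebra ℝ D] [Algebra F D] (d : ℕ) {n : ℕ}

variable (D n) in
/-- The space `𝒮` of Schwartz functions on `M_n(D)`. -/
abbrev MatrixSchwartz : Type _ := SchwartzMap (Matrix (Fin n) (Fin n) D) ℂ

/-- The linear automorphism `x ↦ g⁻¹ x h` of `M_n(D)`. -/
def transEquiv (g h : GLn n D) :
    Matrix (Fin n) (Fin n) D ≃L[ℝ] Matrix (Fin n) (Fin n) D where
  toFun x := (g⁻¹ : GLn n D) * x * h
  invFun x := g * x * (h⁻¹ : GLn n D)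
  left_inv x := by simp [mul_assoc]
  right_inv x := by simp [mul_assoc]
  map_add' x y := by rw [mul_add, add_mul]
  map_smul' c x := by simp
  continuous_toFun := (transHomeo g h).continuous
  continuous_invFun := (transHomeo g h).symm.continuous

/-- The action `((g,h).φ)(x) = |det (g⁻¹ h)|^(d n / 2) φ(g⁻¹ x h)` of `G × G` on the space `𝒮` of
Schwartz functions on `M_n(D)`. -/
def schwartzAct (g h : GLn n D) : MatrixSchwartz D n →L[ℂ] MatrixSchwartz D n :=
  ((detFactor F d g h : ℝ) : ℂ) • SchwartzMap.compCLMOfContinuousLinearEquiv ℂ (transEquiv g h)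

theorem schwartzAct_apply (g h : GLn n D) (φ : MatrixSchwartz D n)
    (x : Matrix (Fin n) (Fin n) D) :
    schwartzAct F d g h φ x =
      ((detFactor F d g h : ℝ) : ℂ) * φ ((g⁻¹ : GLn n D) * x * h) := rfl

theorem schwartzAct_comm (g h : GLn n D) (φ : MatrixSchwartz D n) :
    schwartzAct F d 1 h (schwartzAct F d g 1 φ) = schwartzAct F d g 1 (schwartzAct F d 1 h φ) := by
  refine SchwartzMap.ext fun x => ?_
  rw [schwartzAct_apply, schwartzAct_apply, schwartzAct_apply, schwartzAct_apply]
  simp only [inv_one, Units.val_one, one_mul, mul_one, mul_assoc]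
  ring

variable {W : Type*} [AddCommGroup W] [Module ℂ W] [TopologicalSpace W]

/-- The diagonal action of `g` on `𝒮 ⊗̂ τ`, where `τ` is viewed as a representation of
`G₁ = G × {1}`. -/
def archDiagAct₁ (τ : Representation ℂ (GLn n D) W) (hτ : ∀ g, Continuous (τ g)) (g : GLn n D) :
    CompletedTensor (MatrixSchwartz D n) W →L[ℂ] CompletedTensor (MatrixSchwartz D n) W :=
  completedMap (schwartzAct F d g 1) ⟨τ g, hτ g⟩

/-- The diagonal action of `g` on `𝒮 ⊗̂ τ`, where `τ` is viewed as a representation of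
`G₂ = {1} × G`. -/
def archDiagAct₂ (τ : Representation ℂ (GLn n D) W) (hτ : ∀ g, Continuous (τ g)) (g : GLn n D) :
    CompletedTensor (MatrixSchwartz D n) W →L[ℂ] CompletedTensor (MatrixSchwartz D n) W :=
  completedMap (schwartzAct F d 1 g) ⟨τ g, hτ g⟩

/-- The Hausdorff coinvariants `(𝒮 ⊗̂ τ)_{G₁}`; this is `Θ₁(σ)` when `τ = σ^∨`. -/
abbrev ArchTheta₁ (τ : Representation ℂ (GLn n D) W) (hτ : ∀ g, Continuous (τ g)) : Type _ := HausdorffCoinvariants (archDiagAct₁ F d τ hτ)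

/-- The Hausdorff coinvariants `(𝒮 ⊗̂ τ)_{G₂}`; this is `Θ₂(σ)` when `τ = σ^∨`. -/
abbrev ArchTheta₂ (τ : Representation ℂ (GLn n D) W) (hτ : ∀ g, Continuous (τ g)) : Type _ := HausdorffCoinvariants (archDiagAct₂ F d τ hτ)

/-- The action of `h ∈ G ≅ G₂` on `(𝒮 ⊗̂ τ)_{G₁}`, through its action on `𝒮`. -/
def archTheta₁Act (τ : Representation ℂ (GLn n D) W) (hτ : ∀ g, Continuous (τ g)) (h : GLn n D) :
    ArchTheta₁ F d τ hτ →ₗ[ℂ] ArchTheta₁ F d τ hτ :=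
  Submodule.mapQ _ _
    (completedMap (schwartzAct F d 1 h) (ContinuousLinearMap.id ℂ W)).toLinearMap <|
    closedCoinvariantsKer_le_comap _ _ fun g x =>
      completedMap_comm _ _ (ContinuousLinearMap.id ℂ W) ⟨τ g, hτ g⟩ (schwartzAct_comm F d g h) (fun _ => rfl) x

/-- The action of `g ∈ G ≅ G₁` on `(𝒮 ⊗̂ τ)_{G₂}`, through its action on `𝒮`. -/
def archTheta₂Act (τ : Representation ℂ (GLn n D) W) (hτ : ∀ g, Continuous (τ g)) (g : GLn n D) :
    ArchTheta₂ F d τ hτ →ₗ[ℂ] ArchTheta₂ F d τ hτ :=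
  Submodule.mapQ _ _
    (completedMap (schwartzAct F d g 1) (ContinuousLinearMap.id ℂ W)).toLinearMap <|
    closedCoinvariantsKer_le_comap _ _ fun h x =>
      completedMap_comm _ _ (ContinuousLinearMap.id ℂ W) ⟨τ h, hτ h⟩ (fun φ => (schwartzAct_comm F d g h φ).symm) (fun _ => rfl) x

end ArchTheta

end FullTheta

end

/-!
The Fourier transform on `M_n(D)` exchanges the roles of the two factors of `G × G`, and the theorem
is a formal consequence of this.

Let `t : M_n(D) → F` be a linear form with `t (x y) = t (y x)` for which the pairing
`(x, y) ↦ t (x y)` is nondegenerate, let `ψ` be a nontrivial additive character of `F`, and put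
`(𝓕 φ)(y) = ∫ ψ(t (x y)) φ(x) dx`. The substitution `x ↦ g x h⁻¹` turns the transform of
`x ↦ φ(g⁻¹ x h)` into `y ↦ (𝓕 φ)(h⁻¹ y g)`, multiplied by the Jacobian
`|N(g⁻¹ h)|⁻¹ = |det (g⁻¹ h)| ^ (-d n)`, where `N` is the determinant of the left multiplication on
`M_n(D)`. The exponent `d n / 2` in the definition of the action is precisely the one for which this
means that `𝓕` carries the action of `(g, h)` to that of `(h, g)` (`integral_detFactor_smul`). So
`𝓕 ⊗ id` carries the diagonal action of `G₁` on `𝒮 ⊗ σ^∨` to that of `G₂`, and it descends to the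
coinvariants.

The ingredients are:
* `exists_nondegenerate_trace_form` and `det_pow_eq_norm`, which construct `t` and relate `N` to the
  reduced norm; both rest on the simplicity of the base change of a central simple algebra,
  `isSimpleRing_baseChange`;
* `measure_image_linearEquiv`: over an infinite locally compact field, linear automorphisms scale
  Haar measure by the normalized absolute value of their determinant;
* the bijectivity of `𝓕`. For Bruhat-Schwartz functions it is `IsSelfDual.fourier_bijective`, which
  uses only the interplay of compact open subgroups with their annihilators
  (`isSelfDual_trace_form`). For Schwartz functions, `𝓕` is a linear change of variables away from
  the Fourier transform of a Euclidean space (`exists_schwartz_fourier`).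
-/

open scoped TensorProduct

noncomputable section

namespace FullTheta

/-! ### Central simple algebras: trace forms and norms -/

section CentralSimple

variable {F A : Type*} [Field F] [Ring A] [Algebra F A]

variable (F A) in
/-- The algebra of `F`-linear endomorphisms of `A` generated by the left and right
multiplications. -/
def multiplicationAlgebra : Subalgebra F (Module.End F A) :=
  Algebra.adjoin F (Set.range (LinearMap.mulLeft F) ∪ Set.range (LinearMap.mulRight F))

theorem mulLeft_mem_multiplicationAlgebra (a : A) :
    LinearMap.mulLeft F a ∈ multiplicationAlgebra F A :=
  Algebra.subset_adjoin (Or.inl ⟨a, rfl⟩)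

theorem mulRight_mem_multiplicationAlgebra (a : A) :
    LinearMap.mulRight F a ∈ multiplicationAlgebra F A :=
  Algebra.subset_adjoin (Or.inr ⟨a, rfl⟩)

theorem isSimpleModule_multiplicationAlgebra [IsSimpleRing A] :
    IsSimpleModule (multiplicationAlgebra F A) A := by
  have hl : ∀ (N : Submodule (multiplicationAlgebra F A) A) (a x : A), x ∈ N → a * x ∈ N :=
    fun N a x hx => N.smul_mem ⟨_, mulLeft_mem_multiplicationAlgebra a⟩ hx
  have hr : ∀ (N : Submodule (multiplicationAlgebra F A) A) (a x : A), x ∈ N → x * a ∈ N :=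
    fun N a x hx => N.smul_mem ⟨_, mulRight_mem_multiplicationAlgebra a⟩ hx
  refine (isSimpleModule_iff _ _).2 { exists_pair_ne := ⟨⊥, ⊤, bot_ne_top⟩, eq_bot_or_eq_top := ?_ }
  intro N
  let I : TwoSidedIdeal A := TwoSidedIdeal.mk' N N.zero_mem N.add_mem
    (fun {x} hx => by simpa using hl N (-1) x hx)
    (fun {a x} hx => hl N a x hx) (fun {x a} hx => hr N a x hx)
  have hI : ∀ x, x ∈ I ↔ x ∈ N := fun x => TwoSidedIdeal.mem_mk' ..
  rcases eq_bot_or_eq_top I with h | h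
  · refine Or.inl ((Submodule.eq_bot_iff _).2 fun x hx => ?_)
    have := (hI x).2 hx
    rwa [h, TwoSidedIdeal.mem_bot] at this
  · refine Or.inr (eq_top_iff.2 fun x _ => (hI x).1 ?_)
    rw [h]; trivial

/-- In a central simple algebra of finite dimension, every linear endomorphism is a combination of
left and right multiplications: by simplicity `A` is a simple module over the algebra they generate,
by centrality its endomorphisms are the scalars, and the density theorem applies. -/
theorem mem_multiplicationAlgebra [IsSimpleRing A] [Algebra.IsCentral F A] [FiniteDimensional F A]
    (T : Module.End F A) : T ∈ multiplicationAlgebra F A := by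
  have := isSimpleModule_multiplicationAlgebra (F := F) (A := A)
  have hcent : ∀ f : Module.End (multiplicationAlgebra F A) A, ∃ c : F, ∀ x, f x = c • x := by
    intro f
    have h1 : ∀ x, f x = x * f 1 := fun x => by
      have := f.map_smul ⟨_, mulLeft_mem_multiplicationAlgebra x⟩ (1 : A)
      change f (x * 1) = x * f 1 at this
      rwa [mul_one] at this
    have h2 : ∀ x, f x = f 1 * x := fun x => by
      have := f.map_smul ⟨_, mulRight_mem_multiplicationAlgebra x⟩ (1 : A)
      change f (1 * x) = f 1 * x at this
      rwa [one_mul] at this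
    obtain ⟨c, hc⟩ := (Algebra.IsCentral.mem_center_iff F).1
      (Subalgebra.mem_center_iff.2 fun x => (h1 x).symm.trans (h2 x))
    exact ⟨c, fun x => by rw [h2, hc, Algebra.smul_def]⟩
  let T' : Module.End (Module.End (multiplicationAlgebra F A) A) A :=
    { toFun := T
      map_add' := map_add T
      map_smul' := fun f x => by
        obtain ⟨c, hc⟩ := hcent f
        simp [hc] }
  let b := Module.finBasis F A
  classical
  obtain ⟨r, hr⟩ := jacobson_density (R := multiplicationAlgebra F A) T' (Finset.univ.image b)
  have : T = r.1 := b.ext fun i => hr (b i) (by simp)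
  rw [this]
  exact r.2

/-- Base change preserves simplicity of central simple algebras. -/
theorem isSimpleRing_baseChange (K : Type*) [Field K] [Algebra F K] [IsSimpleRing A]
    [Algebra.IsCentral F A] [FiniteDimensional F A] : IsSimpleRing (K ⊗[F] A) := by
  refine (IsSimpleRing.iff_injective_ringHom _).2 fun {S} _ _ f => ?_
  rw [injective_iff_map_eq_zero]
  intro x hx
  -- The kernel is stable under `id ⊗ T` for every endomorphism `T` of `A`.
  have hstab : ∀ T : Module.End F A, ∀ x, f x = 0 → f (T.lTensor K x) = 0 := by
    intro T
    induction mem_multiplicationAlgebra T using Algebra.adjoin_induction with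
    | mem T hT =>
      intro x hx
      rcases hT with ⟨a, rfl⟩ | ⟨a, rfl⟩
      · have : (LinearMap.mulLeft F a).lTensor K = LinearMap.mulLeft F ((1 : K) ⊗ₜ[F] a) :=
          TensorProduct.ext' fun k y => by simp
        rw [this, LinearMap.mulLeft_apply, map_mul, hx, mul_zero]
      · have : (LinearMap.mulRight F a).lTensor K = LinearMap.mulRight F ((1 : K) ⊗ₜ[F] a) :=
          TensorProduct.ext' fun k y => by simp
        rw [this, LinearMap.mulRight_apply, map_mul, hx, zero_mul]
    | algebraMap c =>
      intro x hx
      have : (algebraMap F (Module.End F A) c).lTensor K =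
          LinearMap.mulLeft F ((1 : K) ⊗ₜ[F] algebraMap F A c) :=
        TensorProduct.ext' fun k y => by simp [Algebra.smul_def]
      rw [this, LinearMap.mulLeft_apply, map_mul, hx, mul_zero]
    | add S T _ _ hS hT => intro x hx; simp [LinearMap.lTensor_add, hS x hx, hT x hx]
    | mul S T _ _ hS hT =>
      intro x hx
      rw [LinearMap.lTensor_mul]
      exact hS _ (hT x hx)
  have hscal : ∀ k : K, f (k ⊗ₜ 1) = 0 → k = 0 := by
    intro k hk
    by_contra hk0
    refine one_ne_zero (α := S) ?_
    calc (1 : S) = f ((k⁻¹ ⊗ₜ 1) * (k ⊗ₜ 1)) := by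
          rw [Algebra.TensorProduct.tmul_mul_tmul, inv_mul_cancel₀ hk0, mul_one,
            ← Algebra.TensorProduct.one_def, map_one]
      _ = 0 := by rw [map_mul, hk, mul_zero]
  let b := Module.finBasis F A
  refine (b.baseChange K).ext_elem fun i => ?_
  rw [map_zero, Finsupp.zero_apply]
  refine hscal _ ?_
  have h1 := hstab ((b.coord i).smulRight 1) x hx
  suffices h : ((b.coord i).smulRight (1 : A)).lTensor K x = ((b.baseChange K).repr x i) ⊗ₜ 1 by
    rwa [h] at h1
  clear h1 hx
  induction x using TensorProduct.induction_on with
  | zero => simp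
  | tmul k y => simp [TensorProduct.smul_tmul]
  | add x y h1 h2 => simp [h1, h2, TensorProduct.add_tmul]

/-- Left multiplication by a square matrix `M` of size `m` has determinant `det M ^ m`. -/
theorem norm_matrix {K : Type*} [Field K] {m : ℕ} (M : Matrix (Fin m) (Fin m) K) :
    Algebra.norm K M = M.det ^ m := by
  have h : LinearMap.toMatrix (Matrix.stdBasis K (Fin m) (Fin m))
      (Matrix.stdBasis K (Fin m) (Fin m)) (Algebra.lmul K _ M) =
      Matrix.kroneckerMap (· * ·) M (1 : Matrix (Fin m) (Fin m) K) := by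
    ext ⟨i, j⟩ ⟨k, l⟩
    rw [LinearMap.toMatrix_apply, Matrix.stdBasis_eq_single]
    rcases eq_or_ne j l with rfl | h
    · simp [Matrix.stdBasis, Matrix.mul_apply, Matrix.single_apply]
    · simp [Matrix.stdBasis, Matrix.mul_apply, h, h.symm]
  rw [Algebra.norm_apply, ← LinearMap.det_toMatrix (Matrix.stdBasis K (Fin m) (Fin m)), h,
    Matrix.det_kronecker]
  simp

/-- Under a splitting `φ : A → M_m(K)` of a central simple algebra `A` of dimension `m ^ 2`, the
determinant of `φ a` is an `m`-th root of the norm of `a`, the determinant of the left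
multiplication by `a`. -/
theorem det_pow_eq_norm {K : Type*} [Field K] [Algebra F K] [IsSimpleRing A]
    [Algebra.IsCentral F A] [FiniteDimensional F A] {m : ℕ} (hm : m ^ 2 = Module.finrank F A)
    (φ : A →ₐ[F] Matrix (Fin m) (Fin m) K) (a : A) :
    (φ a).det ^ m = algebraMap F K (Algebra.norm F a) := by
  have := isSimpleRing_baseChange (F := F) (A := A) K
  have hm0 : m ≠ 0 := by
    rintro rfl
    exact (Module.finrank_pos (R := F) (M := A)).ne hm
  have : NeZero m := ⟨hm0⟩
  let Φ : K ⊗[F] A →ₐ[K] Matrix (Fin m) (Fin m) K := Algebra.TensorProduct.lift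
    (Algebra.ofId K _) φ (fun k a => Algebra.commutes k (φ a))
  have hinj : Function.Injective Φ := Φ.toRingHom.injective
  have hdim : Module.finrank K (K ⊗[F] A) = Module.finrank K (Matrix (Fin m) (Fin m) K) := by
    rw [Module.finrank_baseChange, ← hm, Module.finrank_matrix]
    simp [sq]
  let e : K ⊗[F] A ≃ₗ[K] Matrix (Fin m) (Fin m) K :=
    LinearEquiv.ofInjectiveOfFinrankEq Φ.toLinearMap hinj hdim
  rw [← norm_matrix, Algebra.norm_apply, Algebra.norm_apply, ← LinearMap.det_baseChange,
    ← LinearMap.det_conj _ e]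
  congr 1
  refine LinearMap.ext fun y => ?_
  obtain ⟨x, rfl⟩ := e.surjective y
  simp only [LinearMap.comp_apply, LinearEquiv.coe_coe, LinearEquiv.symm_apply_apply]
  have h1 : ∀ x, e x = Φ x := fun x => rfl
  rw [h1, h1]
  induction x using TensorProduct.induction_on with
  | zero => simp
  | tmul k y =>
    have h2 : ∀ k y, Φ (k ⊗ₜ[F] y) = k • φ y := fun k y => by
      rw [Algebra.smul_def]
      exact Algebra.TensorProduct.lift_tmul ..
    simp [h2]
  | add x y h1 h2 => simp only [map_add, h1, h2]

/-- Over an algebraic closure, a central simple algebra is split. -/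
theorem exists_splitting [IsSimpleRing A] [Algebra.IsCentral F A] [FiniteDimensional F A] :
    ∃ (m : ℕ) (_ : NeZero m),
      Nonempty (AlgebraicClosure F ⊗[F] A ≃ₐ[AlgebraicClosure F]
        Matrix (Fin m) (Fin m) (AlgebraicClosure F)) := by
  have := isSimpleRing_baseChange (F := F) (A := A) (AlgebraicClosure F)
  exact IsSimpleRing.exists_algEquiv_matrix_of_isAlgClosed _ _

/-- A central simple algebra carries a nonzero trace form. In positive characteristic the trace of
the regular representation may vanish, so its existence is read off from the trace of matrices
after splitting: commutators do not span the whole algebra. -/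
theorem exists_trace_form [IsSimpleRing A] [Algebra.IsCentral F A] [FiniteDimensional F A] :
    ∃ t : A →ₗ[F] F, t ≠ 0 ∧ ∀ x y, t (x * y) = t (y * x) := by
  let C : Submodule F A := Submodule.span F {z | ∃ x y : A, z = x * y - y * x}
  have hC : C ≠ ⊤ := by
    intro htop
    obtain ⟨m, hm, ⟨e⟩⟩ := exists_splitting (F := F) (A := A)
    let K := AlgebraicClosure F
    have h1 : ∀ a ∈ C, Matrix.trace (e (1 ⊗ₜ a)) = 0 := by
      intro a ha
      induction ha using Submodule.span_induction with
      | mem z hz =>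
        obtain ⟨x, y, rfl⟩ := hz
        have : ∀ x y : A, (1 : K) ⊗ₜ[F] (x * y) = (1 ⊗ₜ x) * (1 ⊗ₜ y) := fun x y => by simp
        rw [TensorProduct.tmul_sub, this, this, map_sub, map_mul, map_mul, Matrix.trace_sub,
          Matrix.trace_mul_comm, sub_self]
      | zero => simp
      | add x y _ _ hx hy =>
        rw [TensorProduct.tmul_add, map_add, Matrix.trace_add, hx, hy, add_zero]
      | smul c x _ hx =>
        have : (1 : K) ⊗ₜ[F] (c • x) = (algebraMap F K c) • (1 ⊗ₜ[F] x) := by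
          rw [TensorProduct.smul_tmul', ← TensorProduct.smul_tmul, Algebra.smul_def, smul_eq_mul]
        rw [this, map_smul, Matrix.trace_smul, hx, smul_zero]
    have h2 : ∀ z : K ⊗[F] A, Matrix.trace (e z) = 0 := by
      intro z
      induction z using TensorProduct.induction_on with
      | zero => simp
      | tmul k a =>
        have : k ⊗ₜ[F] a = k • ((1 : K) ⊗ₜ[F] a) := by simp [TensorProduct.smul_tmul']
        rw [this, map_smul, Matrix.trace_smul, h1 a (by rw [htop]; trivial), smul_zero]
      | add x y hx hy => rw [map_add, Matrix.trace_add, hx, hy, add_zero]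
    have h3 := h2 (e.symm (Matrix.single 0 0 1))
    rw [AlgEquiv.apply_symm_apply, Matrix.trace_single_eq_same] at h3
    exact one_ne_zero h3
  obtain ⟨t, ht, hle⟩ := Submodule.exists_le_ker_of_lt_top C (lt_top_iff_ne_top.2 hC)
  refine ⟨t, ht, fun x y => ?_⟩
  have : x * y - y * x ∈ LinearMap.ker t := hle (Submodule.subset_span ⟨x, y, rfl⟩)
  rwa [LinearMap.mem_ker, map_sub, sub_eq_zero] at this

/-- A central simple algebra carries a trace form `t` for which the pairing `(x, y) ↦ t (x y)` is
nondegenerate: the radical of the pairing of a nonzero trace form is a proper two-sided ideal. -/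
theorem exists_nondegenerate_trace_form [IsSimpleRing A] [Algebra.IsCentral F A]
    [FiniteDimensional F A] :
    ∃ t : A →ₗ[F] F, (∀ x y, t (x * y) = t (y * x)) ∧ ∀ x, (∀ y, t (x * y) = 0) → x = 0 := by
  obtain ⟨t, ht, hcomm⟩ := exists_trace_form (F := F) (A := A)
  refine ⟨t, hcomm, ?_⟩
  let I : TwoSidedIdeal A := TwoSidedIdeal.mk' {x | ∀ y, t (x * y) = 0} (by simp)
    (fun {x x'} hx hx' y => by rw [add_mul, map_add, hx, hx', add_zero])
    (fun {x} hx y => by rw [neg_mul, map_neg, hx, neg_zero])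
    (fun {a x} hx y => by rw [mul_assoc, hcomm, mul_assoc, hx])
    (fun {x a} hx y => by rw [mul_assoc, hx])
  have hI : ∀ x, x ∈ I ↔ ∀ y, t (x * y) = 0 := fun x => TwoSidedIdeal.mem_mk' ..
  rcases eq_bot_or_eq_top I with h | h
  · intro x hx
    have := (hI x).2 hx
    rwa [h, TwoSidedIdeal.mem_bot] at this
  · refine absurd (LinearMap.ext fun y => ?_) ht
    have := (hI 1).1 (by rw [h]; trivial) y
    rwa [one_mul] at this

/-- The left and the right multiplication by an element of a central simple algebra have the same
determinant, being adjoint to each other for a nondegenerate trace form. -/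
theorem det_mulRight_eq_norm [IsSimpleRing A] [Algebra.IsCentral F A] [FiniteDimensional F A]
    (a : A) : LinearMap.det (LinearMap.mulRight F a) = Algebra.norm F a := by
  obtain ⟨t, hcomm, hnd⟩ := exists_nondegenerate_trace_form (F := F) (A := A)
  let B : A →ₗ[F] Module.Dual F A := (LinearMap.mul F A).compr₂ t
  have hB : ∀ x y, B x y = t (x * y) := fun x y => rfl
  have hinj : Function.Injective B := by
    rw [injective_iff_map_eq_zero]
    exact fun x hx => hnd x fun y => by rw [← hB, hx, LinearMap.zero_apply]
  let e : A ≃ₗ[F] Module.Dual F A :=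
    LinearEquiv.ofInjectiveOfFinrankEq B hinj Subspace.dual_finrank_eq.symm
  rw [Algebra.norm_apply, ← LinearMap.det_dualMap, ← LinearMap.det_conj _ e]
  congr 1
  refine LinearMap.ext fun y => ?_
  obtain ⟨x, rfl⟩ := e.surjective y
  refine LinearMap.ext fun y => ?_
  simp only [LinearMap.comp_apply, LinearEquiv.coe_coe, LinearEquiv.symm_apply_apply]
  have h1 : ∀ x, e x = B x := fun x => rfl
  rw [h1, h1, LinearMap.dualMap_apply, hB, hB, LinearMap.mulRight_apply, Algebra.coe_lmul_eq_mul,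
    LinearMap.mul_apply', mul_assoc, hcomm a, mul_assoc]

end CentralSimple

/-! ### Linear maps and Haar measure -/

section Modulus

open MeasureTheory Measure
open scoped Pointwise

/-- Computation of the factor by which an automorphism `u` of `X` scales Haar measure from its
effect on a quotient `p : X → Y`. Instead of Fubini's theorem, which would need countability
assumptions, one restricts the Haar measure of `X` to a tube `K` around a section of `p`, stable
under `u` and under translation along the section, and pushes it forward to a Haar measure of
`Y`. -/
theorem distribHaarChar_eq_of_tube {X Y G H : Type*} [Group G] [Group H]
    [AddCommGroup X] [TopologicalSpace X] [IsTopologicalAddGroup X] [LocallyCompactSpace X]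
    [DistribMulAction G X] [ContinuousConstSMul G X]
    [AddCommGroup Y] [TopologicalSpace Y] [IsTopologicalAddGroup Y] [LocallyCompactSpace Y]
    [T2Space Y] [DistribMulAction H Y] [ContinuousConstSMul H Y]
    (p : X → Y) (hp : Continuous p) (s : Y → X) (K : Set X)
    (hps : ∀ t x, p (s t + x) = t + p x) (hKs : ∀ t x, s t + x ∈ K ↔ x ∈ K)
    (hcomp : ∀ B, IsCompact B → IsCompact (p ⁻¹' B ∩ K))
    (hint : ∀ U, IsOpen U → U.Nonempty → (interior (p ⁻¹' U ∩ K)).Nonempty)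
    (u : G) (c : H) (huc : ∀ x, p (u • x) = c • p x) (huK : ∀ x, u • x ∈ K ↔ x ∈ K) :
    distribHaarChar X u = distribHaarChar Y c := by
  borelize X Y
  let μ : Measure X := addHaar
  let ν : Measure Y := (μ.restrict K).map p
  have hν : ∀ B, MeasurableSet B → ν B = μ (p ⁻¹' B ∩ K) := fun B hB => by
    rw [Measure.map_apply hp.measurable hB, Measure.restrict_apply (hp.measurable hB)]
  have hinv : ν.IsAddLeftInvariant := by
    refine ⟨fun t => Measure.ext fun B hB => ?_⟩
    rw [Measure.map_apply (measurable_const_add t) hB, hν _ (measurable_const_add t hB), hν B hB,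
      ← measure_preimage_add μ (s t) (p ⁻¹' B ∩ K)]
    congr 1
    ext x
    simp [hps, hKs]
  have hfin : IsFiniteMeasureOnCompacts ν := ⟨fun B hB => by
    rw [hν _ hB.measurableSet]
    exact (hcomp B hB).measure_lt_top⟩
  have hopen : ν.IsOpenPosMeasure := ⟨fun U hU hne => by
    rw [hν _ hU.measurableSet]
    exact (measure_pos_of_nonempty_interior μ (hint U hU hne)).ne'⟩
  have hHaar : ν.IsAddHaarMeasure := { }
  obtain ⟨C, hC, hC0⟩ := exists_compact_mem_nhds (0 : Y)
  have hC1 : ν C ≠ 0 := (measure_pos_of_mem_nhds ν hC0).ne'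
  have hC2 : ν C ≠ ⊤ := hC.measure_lt_top.ne
  have hY : ν (c • C) = distribHaarChar Y c * ν C := by
    have := measure_isAddInvariant_eq_smul_of_isCompact_closure (DomMulAct.mk c • ν) ν
      (s := C) hC.closure
    rw [addHaarScalarFactor_smul_eq_distribHaarChar, domSMul_apply] at this
    exact this
  have hX : distribHaarChar X u * ν C = ν (c • C) := by
    rw [hν _ hC.measurableSet, hν _ (hC.smul c).measurableSet, distribHaarChar_mul]
    congr 1
    ext x
    rw [Set.mem_smul_set_iff_inv_smul_mem]
    have h1 := huc (u⁻¹ • x)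
    have h2 := huK (u⁻¹ • x)
    rw [smul_inv_smul] at h1 h2
    simp only [Set.mem_inter_iff, Set.mem_preimage, h1, h2, Set.smul_mem_smul_set_iff]
  rw [hY] at hX
  exact_mod_cast (ENNReal.mul_left_inj hC1 hC2).1 hX

end Modulus

section LinearAction

/-- Linear endomorphisms act continuously on a module with its module topology. -/
theorem continuousConstSMul_end {F X : Type*} [Field F] [TopologicalSpace F]
    [AddCommGroup X] [Module F X] [TopologicalSpace X]
    [IsTopologicalAddGroup X] [IsModuleTopology F X] :
    ContinuousConstSMul (Module.End F X) X :=
  ⟨fun f => IsModuleTopology.continuous_of_linearMap f⟩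

/-- The linear automorphism given by an invertible matrix. -/
def matrixEnd {F ι : Type*} [Field F] [Fintype ι] [DecidableEq ι] :
    (Matrix ι ι F)ˣ →* (Module.End F (ι → F))ˣ :=
  Units.map (Matrix.toLinAlgEquiv' (R := F) (n := ι)).toAlgHom.toRingHom.toMonoidHom

theorem matrixEnd_smul {F ι : Type*} [Field F] [Fintype ι] [DecidableEq ι]
    (M : (Matrix ι ι F)ˣ) (x : ι → F) :
    matrixEnd M • x = (M : Matrix ι ι F).mulVec x := rfl

end LinearAction

section DetModulus

open MeasureTheory
open scoped Pointwise

variable {F : Type*} [Field F] [TopologicalSpace F] [IsTopologicalRing F]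
  [LocallyCompactSpace F]

@[simp] theorem normalizedAbs_zero : normalizedAbs (0 : F) = 0 := by simp [normalizedAbs]

theorem normalizedAbs_units (x : Fˣ) : normalizedAbs (x : F) = distribHaarChar F x := by
  simp [normalizedAbs]

theorem normalizedAbs_of_ne_zero {x : F} (hx : x ≠ 0) :
    normalizedAbs x = distribHaarChar F (Units.mk0 x hx) := by
  simp [normalizedAbs, hx]

theorem normalizedAbs_pos {x : F} (hx : x ≠ 0) : 0 < normalizedAbs x := by
  rw [normalizedAbs_of_ne_zero hx]
  exact_mod_cast distribHaarChar_pos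

theorem normalizedAbs_one : normalizedAbs (1 : F) = 1 := by
  simpa using normalizedAbs_units (1 : Fˣ)

theorem normalizedAbs_mul (x y : F) :
    normalizedAbs (x * y) = normalizedAbs x * normalizedAbs y := by
  rcases eq_or_ne x 0 with rfl | hx
  · simp
  rcases eq_or_ne y 0 with rfl | hy
  · simp
  have := normalizedAbs_units (Units.mk0 x hx * Units.mk0 y hy)
  rw [map_mul, NNReal.coe_mul, ← normalizedAbs_units, ← normalizedAbs_units] at this
  exact this

theorem normalizedAbs_pow (x : F) (k : ℕ) : normalizedAbs (x ^ k) = normalizedAbs x ^ k := by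
  induction k with
  | zero => simp [normalizedAbs_one]
  | succ k ih => rw [pow_succ, pow_succ, normalizedAbs_mul, ih]

attribute [local instance] continuousConstSMul_end

theorem distribHaarChar_single [T2Space F] {ι : Type*} [Fintype ι] [DecidableEq ι] (i : ι) (c : Fˣ)
    (M : (Matrix ι ι F)ˣ) (hM : (M : Matrix ι ι F) = Matrix.diagonal (Pi.mulSingle i (c : F))) :
    distribHaarChar (ι → F) (matrixEnd M) = distribHaarChar F c := by
  obtain ⟨C, hC, hC0⟩ := exists_compact_mem_nhds (0 : F)
  have hcoord : ∀ (x : ι → F) (j : ι),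
      (matrixEnd M • x) j = (Pi.mulSingle i (c : F) : ι → F) j * x j := fun x j => by
    rw [matrixEnd_smul, hM, Matrix.mulVec_diagonal]
  refine distribHaarChar_eq_of_tube (fun x : ι → F => x i) (continuous_apply i)
    (fun t => Pi.single i t)
    {x | ∀ j, j ≠ i → x j ∈ C} ?_ ?_ ?_ ?_ _ _ ?_ ?_
  · simp
  · intro t x
    refine forall₂_congr fun j hj => ?_
    simp [hj]
  · intro B hB
    convert! isCompact_univ_pi (s := Function.update (fun _ => C) i B) (fun j => ?_) using 1
    · ext x
      simp only [Set.mem_inter_iff, Set.mem_preimage, Set.mem_ofPred_eq, Set.mem_univ_pi]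
      constructor
      · rintro ⟨h1, h2⟩ j
        rcases eq_or_ne j i with rfl | hj
        · simpa
        · simpa [hj] using h2 j hj
      · exact fun h => ⟨by simpa using h i, fun j hj => by simpa [hj] using h j⟩
    · rcases eq_or_ne j i with rfl | hj
      · simpa
      · simpa [hj]
  · rintro U hU ⟨t, ht⟩
    refine ⟨Pi.single i t, mem_interior_iff_mem_nhds.2 (Filter.inter_mem ?_ ?_)⟩
    · exact (hU.preimage (continuous_apply i)).mem_nhds (by simpa)
    · have : ({i}ᶜ : Set ι).pi (fun _ => C) ∈ nhds (Pi.single i t : ι → F) :=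
        set_pi_mem_nhds (Set.toFinite _) fun j hj => by
          have : j ≠ i := hj
          simpa [this]
      convert! this using 1
  · intro x
    rw [hcoord, Pi.mulSingle_eq_same]; rfl
  · intro x
    refine forall₂_congr fun j hj => ?_
    rw [hcoord, Pi.mulSingle_eq_of_ne hj, one_mul]

/-- Transvections preserve Haar measure: each is a commutator of a transvection with a diagonal
matrix, as soon as the field has an element other than `0` and `1`. -/
theorem distribHaarChar_transvection [Infinite F] {ι : Type*} [Fintype ι] [DecidableEq ι]
    (t : Matrix.TransvectionStruct ι F) (M : (Matrix ι ι F)ˣ)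
    (hM : (M : Matrix ι ι F) = t.toMatrix) :
    distribHaarChar (ι → F) (matrixEnd M) = 1 := by
  classical
  obtain ⟨a, ha⟩ := (Set.infinite_univ (α := F)).exists_notMem_finset ({0, 1} : Finset F)
  simp only [Finset.mem_insert, Finset.mem_singleton, not_or] at ha
  obtain ⟨-, ha0, ha1⟩ := ha
  obtain ⟨i, j, hij, c⟩ := t
  have hunit : ∀ b : F, IsUnit (Matrix.transvection i j b) := fun b =>
    (Matrix.isUnit_iff_isUnit_det _).2 (by
      rw [Matrix.det_transvection_of_ne i j hij]; exact isUnit_one)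
  have hdunit : IsUnit (Matrix.diagonal (Pi.mulSingle i a) : Matrix ι ι F) :=
    (Matrix.isUnit_iff_isUnit_det _).2 (by
      rw [Matrix.det_diagonal, Finset.prod_pi_mulSingle']; simpa using ha0)
  obtain ⟨D, hD⟩ := hdunit
  have ha1' : a - 1 ≠ 0 := sub_ne_zero.2 ha1
  -- `D N D⁻¹` is the transvection with coefficient `a (a - 1)⁻¹ c = c + (a - 1)⁻¹ c`
  obtain ⟨N, hN⟩ := hunit ((a - 1)⁻¹ * c)
  have key : D * N = M * N * D := by
    apply Units.ext
    rw [Units.val_mul, Units.val_mul, Units.val_mul, hD, hN, hM,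
      Matrix.TransvectionStruct.toMatrix_mk,
      Matrix.transvection_mul_transvection_same i j hij]
    have : c + (a - 1)⁻¹ * c = a * ((a - 1)⁻¹ * c) := by field_simp; ring
    rw [this, Matrix.transvection, Matrix.transvection, mul_add, add_mul, mul_one, one_mul]
    congr 1
    ext k l
    rw [Matrix.diagonal_mul, Matrix.mul_diagonal]
    rcases eq_or_ne i k with rfl | hk
    · rcases eq_or_ne j l with rfl | hl
      · simp [hij.symm]
      · simp [hl]
    · simp [hk]
  have h := congrArg (fun u => distribHaarChar (ι → F) (matrixEnd u)) key
  simp only [map_mul] at h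
  have h0 : distribHaarChar (ι → F) (matrixEnd D) * distribHaarChar (ι → F) (matrixEnd N) ≠ 0 :=
    (mul_pos distribHaarChar_pos distribHaarChar_pos).ne'
  refine mul_right_cancel₀ h0 ?_
  rw [one_mul]
  exact (h.trans (by ring)).symm

theorem distribHaarChar_diagonal [T2Space F] {ι : Type*} [Fintype ι] [DecidableEq ι]
    (v : ι → Fˣ) (M : (Matrix ι ι F)ˣ)
    (hM : (M : Matrix ι ι F) = Matrix.diagonal fun i => (v i : F)) :
    distribHaarChar (ι → F) (matrixEnd M) = ∏ i, distribHaarChar F (v i) := by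
  let Δ : (ι → Fˣ) →* (Matrix ι ι F)ˣ :=
    (Units.map (Matrix.diagonalRingHom ι F).toMonoidHom).comp MulEquiv.piUnits.symm.toMonoidHom
  have hΔ : ∀ w : ι → Fˣ, (Δ w : Matrix ι ι F) = Matrix.diagonal fun i => (w i : F) := fun w => rfl
  have hMv : M = Δ v := Units.ext (by rw [hM, hΔ])
  let Ψ : (ι → Fˣ) →* NNReal := (distribHaarChar (ι → F)).comp (matrixEnd.comp Δ)
  rw [hMv]
  change Ψ v = _
  conv_lhs => rw [← Finset.univ_prod_mulSingle v, map_prod]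
  refine Finset.prod_congr rfl fun i _ => distribHaarChar_single i (v i) _ ?_
  rw [hΔ]
  congr 1
  ext j
  rcases eq_or_ne j i with rfl | hj
  · simp
  · simp [hj]

theorem distribHaarChar_matrix [T2Space F] [Infinite F] {ι : Type*} [Fintype ι] [DecidableEq ι]
    (M : (Matrix ι ι F)ˣ) :
    (distribHaarChar (ι → F) (matrixEnd M) : ℝ) = normalizedAbs (M : Matrix ι ι F).det := by
  suffices h : ∀ N : Matrix ι ι F, N.det ≠ 0 → ∀ M : (Matrix ι ι F)ˣ, (M : Matrix ι ι F) = N →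
      (distribHaarChar (ι → F) (matrixEnd M) : ℝ) = normalizedAbs N.det from
    h M ((Matrix.isUnit_iff_isUnit_det _).1 M.isUnit).ne_zero M rfl
  intro N hN
  refine Matrix.diagonal_transvection_induction_of_det_ne_zero (fun N => ∀ M : (Matrix ι ι F)ˣ,
    (M : Matrix ι ι F) = N → (distribHaarChar (ι → F) (matrixEnd M) : ℝ) = normalizedAbs N.det)
    N hN ?_ ?_ ?_
  · intro v hv M hM
    rw [Matrix.det_diagonal] at hv
    have hv' : ∀ i, v i ≠ 0 := fun i => Finset.prod_ne_zero_iff.1 hv i (Finset.mem_univ i)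
    rw [distribHaarChar_diagonal (fun i => Units.mk0 (v i) (hv' i)) M hM, Matrix.det_diagonal]
    have := normalizedAbs_units (∏ i, Units.mk0 (v i) (hv' i))
    rw [map_prod, Units.coe_prod] at this
    exact this.symm
  · intro t M hM
    rw [distribHaarChar_transvection t M hM, Matrix.TransvectionStruct.det, normalizedAbs_one]
    rfl
  · intro A B hA hB ihA ihB M hM
    obtain ⟨a, rfl⟩ := (Matrix.isUnit_iff_isUnit_det _).2 (isUnit_iff_ne_zero.2 hA)
    obtain ⟨b, rfl⟩ := (Matrix.isUnit_iff_isUnit_det _).2 (isUnit_iff_ne_zero.2 hB)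
    have : M = a * b := Units.ext hM
    rw [this, map_mul, map_mul, NNReal.coe_mul, ihA a rfl, ihB b rfl, Matrix.det_mul,
      normalizedAbs_mul]

/-- A linear automorphism `f` of a finite dimensional vector space over a locally compact field
scales Haar measure by the normalized absolute value of its determinant. -/
theorem measure_image_linearEquiv [T2Space F] [Infinite F] {X : Type*} [AddCommGroup X] [Module F X]
    [FiniteDimensional F X] [TopologicalSpace X] [IsTopologicalAddGroup X] [IsModuleTopology F X]
    [MeasurableSpace X] [BorelSpace X] (μ : Measure X) [μ.IsAddHaarMeasure] [μ.Regular]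
    (f : X ≃ₗ[F] X) (s : Set X) :
    μ (f '' s) = ENNReal.ofReal (normalizedAbs (LinearMap.det (f : X →ₗ[F] X))) * μ s := by
  let b := Module.finBasis F X
  let ι := Fin (Module.finrank F X)
  let e : X ≃L[F] (ι → F) :=
    { b.equivFun with
      continuous_toFun := IsModuleTopology.continuous_of_linearMap b.equivFun.toLinearMap
      continuous_invFun := IsModuleTopology.continuous_of_linearMap b.equivFun.symm.toLinearMap }
  let _ : MeasurableSpace (ι → F) := borel _
  have : BorelSpace (ι → F) := ⟨rfl⟩
  let ν : Measure (ι → F) := μ.map e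
  have hν : ν.IsAddHaarMeasure := e.isAddHaarMeasure_map μ
  have hreg : ν.Regular := Measure.Regular.map e.toHomeomorph
  have hνs : ∀ s, ν s = μ (e ⁻¹' s) := fun s => e.toHomeomorph.toMeasurableEquiv.map_apply s
  have hdet : IsUnit (LinearMap.toMatrix b b (f : X →ₗ[F] X)) := by
    rw [Matrix.isUnit_iff_isUnit_det, LinearMap.det_toMatrix]
    exact f.isUnit_det'
  obtain ⟨M, hM⟩ := hdet
  have h1 := distribHaarChar_mul ν (matrixEnd M) (e '' s)
  have h2 := distribHaarChar_matrix M
  rw [hM, LinearMap.det_toMatrix] at h2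
  rw [hνs, hνs, Set.preimage_image_eq _ e.injective] at h1
  rw [← h2, ENNReal.ofReal_coe_nnreal, h1]
  congr 1
  ext x
  simp only [Set.mem_image, Set.mem_preimage, Set.mem_smul_set, exists_exists_and_eq_and]
  have h3 : ∀ y, matrixEnd M • e y = e (f y) := fun y => by
    rw [matrixEnd_smul, hM]
    exact LinearMap.toMatrix_mulVec_repr b b _ y
  simp only [h3, e.injective.eq_iff]

variable {A : Type*} [Ring A] [Algebra F A] [TopologicalSpace A] [IsTopologicalRing A]
  [IsModuleTopology F A] [FiniteDimensional F A] [IsSimpleRing A] [Algebra.IsCentral F A]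
  [T2Space F] [Infinite F]

theorem integral_comp_mul_mul [MeasurableSpace A] [BorelSpace A] (μ : Measure A)
    [μ.IsAddHaarMeasure] [μ.Regular] (a b : Aˣ) (f : A → ℂ) :
    ∫ x, f (a * x * b) ∂μ =
      ((normalizedAbs (Algebra.norm F ((a * b : Aˣ) : A)))⁻¹ : ℝ) * ∫ x, f x ∂μ := by
  let T : A ≃ₗ[F] A :=
    { (LinearMap.mulRight F (b : A)).comp (LinearMap.mulLeft F (a : A)) with
      invFun := fun x => (a⁻¹ : Aˣ) * x * (b⁻¹ : Aˣ)
      left_inv := fun x => by simp [mul_assoc]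
      right_inv := fun x => by simp [mul_assoc] }
  let H : A ≃ₜ A :=
    { T.toEquiv with
      continuous_toFun := IsModuleTopology.continuous_of_linearMap T.toLinearMap
      continuous_invFun := IsModuleTopology.continuous_of_linearMap T.symm.toLinearMap }
  have hdet : LinearMap.det (T : A →ₗ[F] A) = Algebra.norm F ((a * b : Aˣ) : A) := by
    have : (T : A →ₗ[F] A) =
        (LinearMap.mulRight F (b : A)).comp (LinearMap.mulLeft F (a : A)) := rfl
    rw [this, LinearMap.det_comp, det_mulRight_eq_norm, Units.val_mul, map_mul, mul_comm]
    rfl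
  have hr : 0 < normalizedAbs (Algebra.norm F ((a * b : Aˣ) : A)) :=
    normalizedAbs_pos (((a * b).isUnit.map (Algebra.norm F)).ne_zero)
  have hmap : μ.map H =
      ENNReal.ofReal (normalizedAbs (Algebra.norm F ((a * b : Aˣ) : A)))⁻¹ • μ := by
    refine Measure.ext fun s hs => ?_
    have h1 := measure_image_linearEquiv (F := F) μ T (T ⁻¹' s)
    rw [Set.image_preimage_eq _ T.surjective, hdet] at h1
    rw [Measure.map_apply H.continuous.measurable hs, Measure.smul_apply, h1, smul_eq_mul,
      ← mul_assoc, ← ENNReal.ofReal_mul (inv_nonneg.2 hr.le), inv_mul_cancel₀ hr.ne',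
      ENNReal.ofReal_one, one_mul]
    rfl
  have h2 := integral_map_equiv (μ := μ) H.toMeasurableEquiv f
  have h3 : (H.toMeasurableEquiv : A → A) = H := rfl
  rw [h3, hmap, integral_smul_measure, ENNReal.toReal_ofReal (inv_nonneg.2 hr.le)] at h2
  rw [← Complex.real_smul, h2]
  rfl

/-- Change of variables in a Fourier integral for the pairing of a trace form `t`. -/
theorem integral_pairing_comp_mul_mul [MeasurableSpace A] [BorelSpace A] (μ : Measure A)
    [μ.IsAddHaarMeasure] [μ.Regular] (t : A →ₗ[F] F) (ht : ∀ x y, t (x * y) = t (y * x))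
    (ψ : F → ℂ) (φ : A → ℂ) (g h : Aˣ) (y : A) :
    ∫ x, ψ (t (x * y)) * φ ((g⁻¹ : Aˣ) * x * h) ∂μ =
      ((normalizedAbs (Algebra.norm F ((g⁻¹ * h : Aˣ) : A)))⁻¹ : ℝ) *
        ∫ x, ψ (t (x * ((h⁻¹ : Aˣ) * y * g))) * φ x ∂μ := by
  rw [← integral_comp_mul_mul (F := F)]
  refine integral_congr_ae (Filter.Eventually.of_forall fun x => ?_)
  have : (g⁻¹ : Aˣ) * x * h * ((h⁻¹ : Aˣ) * y * g) = (g⁻¹ : Aˣ) * (x * y * g) := by simp [mul_assoc]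
  simp only
  rw [this, ht (g⁻¹ : Aˣ), mul_assoc (x * y), Units.mul_inv, mul_one]

end DetModulus

/-! ### The Jacobian and the reduced norm -/

section DetFactor

open MeasureTheory

theorem IsReducedNorm.inv {F A : Type*} [Field F] [Ring A] [Algebra F A] {a : Aˣ} {c : F}
    (h : IsReducedNorm F (a : A) c) : IsReducedNorm F ((a⁻¹ : Aˣ) : A) c⁻¹ := by
  obtain ⟨m, φ, hm, hφ⟩ := h
  refine ⟨m, φ, hm, ?_⟩
  rw [map_inv₀, ← hφ]
  refine eq_inv_of_mul_eq_one_left ?_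
  rw [← Matrix.det_mul, ← map_mul, Units.inv_mul, map_one, Matrix.det_one]

/-- The reduced norm is a root of the norm. -/
theorem reducedNorm_pow_eq_norm {F A : Type*} [Field F] [Ring A] [Algebra F A]
    [FiniteDimensional F A] [IsSimpleRing A] [Algebra.IsCentral F A] {m : ℕ}
    (hm : m ^ 2 = Module.finrank F A) {a : A}
    (ha : ∃ c : F, IsReducedNorm F a c) : reducedNorm F a ^ m = Algebra.norm F a := by
  have h : IsReducedNorm F a (reducedNorm F a) := by
    rw [reducedNorm, dif_pos ha]
    exact ha.choose_spec
  obtain ⟨m', φ, hm', hφ⟩ := h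
  obtain rfl : m = m' := Nat.pow_left_injective (n := 2) two_ne_zero (hm.trans hm'.symm)
  refine (algebraMap F (AlgebraicClosure F)).injective ?_
  rw [map_pow, ← hφ, det_pow_eq_norm hm]

/-- The Jacobian `|N(g⁻¹ h)| = |det (g⁻¹ h)| ^ (d n)` of `x ↦ g⁻¹ x h` is the quotient of the
factors `|det (g⁻¹ h)| ^ (d n / 2)` and `|det (h⁻¹ g)| ^ (d n / 2)`. -/
theorem detFactor_eq_mul_swap {F : Type*} [Field F] [TopologicalSpace F] [IsTopologicalRing F]
    [LocallyCompactSpace F] {D : Type*} [DivisionRing D] [Algebra F D] [FiniteDimensional F D]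
    [Algebra.IsCentral F D] {n d : ℕ} (hn : 1 ≤ n) (hd : Module.finrank F D = d ^ 2)
    (g h : GLn n D) :
    detFactor F d g h = normalizedAbs (Algebra.norm F
      ((g⁻¹ * h : GLn n D) : Matrix (Fin n) (Fin n) D)) * detFactor F d h g := by
  have : Nonempty (Fin n) := ⟨⟨0, hn⟩⟩
  have hd0 : d ≠ 0 := by
    rintro rfl
    exact (Module.finrank_pos (R := F) (M := D)).ne' hd
  have hm : (d * n) ^ 2 = Module.finrank F (Matrix (Fin n) (Fin n) D) := by
    rw [Module.finrank_matrix, hd]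
    simp
    ring
  have hpos : 0 < (d : ℝ) * n := by
    have : 0 < n := hn
    positivity
  set a : GLn n D := g⁻¹ * h with ha
  have ha' : h⁻¹ * g = a⁻¹ := by rw [ha]; group
  unfold detFactor
  rw [← ha, ha']
  by_cases hex : ∃ c : F, IsReducedNorm F (a : Matrix (Fin n) (Fin n) D) c
  · have hex' : ∃ c : F, IsReducedNorm F ((a⁻¹ : GLn n D) : Matrix (Fin n) (Fin n) D) c :=
      ⟨_, hex.choose_spec.inv⟩
    have key : ∀ b : GLn n D, (∃ c : F, IsReducedNorm F (b : Matrix (Fin n) (Fin n) D) c) →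
        normalizedAbs (reducedNorm F (b : Matrix (Fin n) (Fin n) D)) ^ ((d : ℝ) * n / 2) =
          Real.sqrt (normalizedAbs (Algebra.norm F (b : Matrix (Fin n) (Fin n) D))) := by
      intro b hb
      have h0 : 0 ≤ normalizedAbs (reducedNorm F (b : Matrix (Fin n) (Fin n) D)) := by
        rcases eq_or_ne (reducedNorm F (b : Matrix (Fin n) (Fin n) D)) 0 with h | h
        · rw [h, normalizedAbs_zero]
        · exact (normalizedAbs_pos h).le
      rw [← reducedNorm_pow_eq_norm hm hb, normalizedAbs_pow, Real.sqrt_eq_rpow,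
        ← Real.rpow_natCast, ← Real.rpow_mul h0]
      congr 1
      push_cast
      ring
    have h1 : normalizedAbs (Algebra.norm F (a : Matrix (Fin n) (Fin n) D)) *
        normalizedAbs (Algebra.norm F ((a⁻¹ : GLn n D) : Matrix (Fin n) (Fin n) D)) = 1 := by
      rw [← normalizedAbs_mul, ← map_mul, Units.mul_inv, map_one, normalizedAbs_one]
    have h2 : 0 < normalizedAbs (Algebra.norm F (a : Matrix (Fin n) (Fin n) D)) :=
      normalizedAbs_pos ((a.isUnit.map (Algebra.norm F)).ne_zero)
    rw [key a hex, key _ hex', eq_inv_of_mul_eq_one_right h1, Real.sqrt_inv, ← div_eq_mul_inv,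
      Real.div_sqrt]
  · -- This case does not occur, since central simple algebras have reduced norms, but it need not
    -- be excluded: a reduced norm of `a⁻¹` would give one of `a`, so both factors would vanish.
    have hex' : ¬ ∃ c : F, IsReducedNorm F ((a⁻¹ : GLn n D) : Matrix (Fin n) (Fin n) D) c :=
      fun ⟨c, hc⟩ => hex ⟨_, by simpa using hc.inv⟩
    rw [reducedNorm, dif_neg hex, reducedNorm, dif_neg hex', normalizedAbs_zero,
      Real.zero_rpow (by positivity), mul_zero]

end DetFactor

/-! ### The Fourier transform of a self-dual totally disconnected group -/

section SelfDual

open MeasureTheory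

variable {X : Type*} [AddCommGroup X] [TopologicalSpace X]

/-- The annihilator of a set with respect to a bicharacter. -/
def annihilator (χ : X → X → Circle) (hadd : ∀ x y z, χ x (y + z) = χ x y * χ x z) (S : Set X) :
    AddSubgroup X where
  carrier := {y | ∀ x ∈ S, χ x y = 1}
  add_mem' hy hz x hx := by rw [hadd, hy x hx, hz x hx, one_mul]
  zero_mem' x _ := by simpa using hadd x 0 0
  neg_mem' {y} hy x hx := by
    have h0 : χ x 0 = 1 := by simpa using hadd x 0 0
    have h := hadd x y (-y)
    rw [add_neg_cancel, h0, hy x hx, one_mul] at h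
    exact h.symm

/-- A locally constant symmetric bicharacter identifying the totally disconnected locally compact
group `X` with its dual. Only two consequences of self-duality are recorded: open subgroups have
compact annihilators, and there are arbitrarily small compact open subgroups which are equal to
their double annihilators. -/
structure IsSelfDual (χ : X → X → Circle) : Prop where
  map_add : ∀ x y z, χ x (y + z) = χ x y * χ x z
  symm : ∀ x y, χ x y = χ y x
  locallyConstant : IsLocallyConstant fun p : X × X => χ p.1 p.2
  isCompact_annihilator : ∀ K : AddSubgroup X, IsOpen (K : Set X) →
    IsCompact (annihilator χ map_add K : Set X)
  exists_subgroup : ∀ U ∈ nhds (0 : X), ∃ L : AddSubgroup X, IsOpen (L : Set X) ∧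
    IsCompact (L : Set X) ∧ (L : Set X) ⊆ U ∧
    annihilator χ map_add (annihilator χ map_add L : Set X) ≤ L

theorem isOpen_annihilator [IsTopologicalAddGroup X] {χ : X → X → Circle}
    (hadd : ∀ x y z, χ x (y + z) = χ x y * χ x z)
    (hloc : IsLocallyConstant fun p : X × X => χ p.1 p.2) {S : Set X} (hS : IsCompact S) :
    IsOpen (annihilator χ hadd S : Set X) := by
  have h0 : ∀ x, χ x 0 = 1 := fun x => by simpa using hadd x 0 0
  obtain ⟨U, V, -, hV, hSU, h0V, hUV⟩ := generalized_tube_lemma hS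
    (isCompact_singleton (x := (0 : X))) (hloc.isOpen_fiber 1) (by
      rintro ⟨x, y⟩ ⟨-, hy⟩
      rw [Set.mem_singleton_iff] at hy
      simp only at hy
      subst hy
      exact h0 x)
  refine AddSubgroup.isOpen_of_mem_nhds _ (g := 0) ?_
  exact Filter.mem_of_superset (hV.mem_nhds (h0V rfl)) fun y hy x hx =>
    hUV (a := (x, y)) ⟨hSU hx, hy⟩

/-- A locally constant function of compact support is invariant under small translations. -/
theorem exists_nhds_invariant [IsTopologicalAddGroup X] (φ : BruhatSchwartz X) :
    ∃ U ∈ nhds (0 : X), ∀ l ∈ U, ∀ x, φ.1 (x + l) = φ.1 x := by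
  have hloc : IsLocallyConstant fun p : X × X => φ.1 (p.1 + p.2) - φ.1 p.1 :=
    (φ.2.1.comp_continuous continuous_add).sub (φ.2.1.comp_continuous continuous_fst)
  obtain ⟨U, V, -, hV, hSU, h0V, hUV⟩ := generalized_tube_lemma φ.2.2
    (isCompact_singleton (x := (0 : X))) (hloc.isOpen_fiber 0) (by
      rintro ⟨x, y⟩ ⟨-, hy⟩
      rw [Set.mem_singleton_iff] at hy
      simp only at hy
      subst hy
      simp)
  have hV0 : V ∈ nhds (0 : X) := hV.mem_nhds (h0V rfl)
  have key : ∀ x ∈ tsupport φ.1, ∀ l ∈ V, φ.1 (x + l) = φ.1 x := fun x hx l hl =>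
    sub_eq_zero.1 (hUV (a := (x, l)) ⟨hSU hx, hl⟩)
  refine ⟨V ∩ -V, Filter.inter_mem hV0 (neg_mem_nhds_zero X hV0), fun l hl x => ?_⟩
  by_cases hx : x ∈ tsupport φ.1
  · exact key x hx l hl.1
  by_cases hxl : x + l ∈ tsupport φ.1
  · simpa using (key _ hxl (-l) hl.2).symm
  · rw [image_eq_zero_of_notMem_tsupport hx, image_eq_zero_of_notMem_tsupport hxl]

namespace IsSelfDual

variable {χ : X → X → Circle} (hχ : IsSelfDual χ)

include hχ

theorem map_add_left (x y z : X) : χ (x + y) z = χ x z * χ y z := by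
  rw [hχ.symm, hχ.map_add, hχ.symm z, hχ.symm z]

theorem continuous_coe : Continuous fun p : X × X => (χ p.1 p.2 : ℂ) :=
  continuous_induced_dom.comp hχ.locallyConstant.continuous

theorem integrable [IsTopologicalAddGroup X] [MeasurableSpace X] [BorelSpace X] (μ : Measure X)
    [IsFiniteMeasureOnCompacts μ] (φ : BruhatSchwartz X) (y : X) :
    Integrable (fun x => (χ x y : ℂ) * φ.1 x) μ := by
  refine Continuous.integrable_of_hasCompactSupport ?_ φ.2.2.mul_left
  exact (hχ.continuous_coe.comp (Continuous.prodMk_left y)).mul φ.2.1.continuous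

/-- A function invariant under translation by `l` has no Fourier coefficient at the characters that
are nontrivial at `l`. -/
theorem integral_eq_zero [IsTopologicalAddGroup X] [MeasurableSpace X] [BorelSpace X]
    (μ : Measure X) [μ.IsAddLeftInvariant] {f : X → ℂ} {y l : X}
    (hl : χ l y ≠ 1) (hf : ∀ x, f (x + l) = f x) : ∫ x, (χ x y : ℂ) * f x ∂μ = 0 := by
  have h := integral_add_right_eq_self (μ := μ) (fun x => (χ x y : ℂ) * f x) l
  simp only [hχ.map_add_left, hf, Circle.coe_mul] at h
  have h2 : (χ l y : ℂ) * ∫ x, (χ x y : ℂ) * f x ∂μ = ∫ x, (χ x y : ℂ) * f x ∂μ := by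
    rw [← integral_const_mul, ← h]
    exact integral_congr_ae (Filter.Eventually.of_forall fun x => by simp only; ring)
  by_contra h0
  exact hl (Circle.coe_injective (by simpa using mul_right_cancel₀ h0 (h2.trans (one_mul _).symm)))

theorem hasCompactSupport_fourier [IsTopologicalAddGroup X] [T2Space X] [MeasurableSpace X]
    [BorelSpace X] (μ : Measure X) [μ.IsAddLeftInvariant] {f : X → ℂ} (L : AddSubgroup X)
    (hL : IsOpen (L : Set X)) (hf : ∀ l ∈ L, ∀ x, f (x + l) = f x) :
    HasCompactSupport fun y => ∫ x, (χ x y : ℂ) * f x ∂μ :=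
  HasCompactSupport.intro (hχ.isCompact_annihilator L hL) fun y hy => by
    have : ∃ l ∈ L, χ l y ≠ 1 := by
      by_contra! h
      exact hy h
    obtain ⟨l, hl, hly⟩ := this
    exact hχ.integral_eq_zero μ hly (hf l hl)

/-- The Fourier transform of Bruhat-Schwartz functions attached to a self-duality. -/
def fourier [IsTopologicalAddGroup X] [T2Space X] [MeasurableSpace X] [BorelSpace X]
    (μ : Measure X) [μ.IsAddHaarMeasure] : BruhatSchwartz X →ₗ[ℂ] BruhatSchwartz X where
  toFun φ := ⟨fun y => ∫ x, (χ x y : ℂ) * φ.1 x ∂μ, by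
    constructor
    · refine (IsLocallyConstant.iff_eventually_eq _).2 fun y => ?_
      have hopen := isOpen_annihilator hχ.map_add hχ.locallyConstant φ.2.2.isCompact
      have hmem : (fun y' => y' - y) ⁻¹' (annihilator χ hχ.map_add (tsupport φ.1)) ∈ nhds y :=
        (hopen.preimage (continuous_sub_right y)).mem_nhds (by simp [zero_mem])
      filter_upwards [hmem] with y' hy'
      refine integral_congr_ae (Filter.Eventually.of_forall fun x => ?_)
      by_cases hx : x ∈ tsupport φ.1
      · have h := hχ.map_add x (y' - y) y
        rw [sub_add_cancel, hy' x hx, one_mul] at h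
        simp only [h]
      · simp only [image_eq_zero_of_notMem_tsupport hx, mul_zero]
    · obtain ⟨U, hU, hinv⟩ := exists_nhds_invariant φ
      obtain ⟨L, hL, -, hLU, -⟩ := hχ.exists_subgroup U hU
      exact hχ.hasCompactSupport_fourier μ L hL fun l hl => hinv l (hLU hl)⟩
  map_add' φ φ' := by
    ext y
    simp only [Submodule.coe_add, Pi.add_apply, mul_add]
    exact integral_add (hχ.integrable μ φ y) (hχ.integrable μ φ' y)
  map_smul' c φ := by
    ext y
    simp only [Submodule.coe_smul, Pi.smul_apply, smul_eq_mul, RingHom.id_apply]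
    rw [← integral_const_mul]
    exact integral_congr_ae (Filter.Eventually.of_forall fun x => by simp only; ring)

theorem fourier_apply [IsTopologicalAddGroup X] [T2Space X] [MeasurableSpace X] [BorelSpace X]
    (μ : Measure X) [μ.IsAddHaarMeasure] (φ : BruhatSchwartz X) (y : X) :
    (hχ.fourier μ φ).1 y = ∫ x, (χ x y : ℂ) * φ.1 x ∂μ := rfl

/-- Orthogonality: a character integrates over a compact subgroup to zero unless it is trivial. -/
theorem integral_indicator [IsTopologicalAddGroup X] [MeasurableSpace X] [BorelSpace X]
    (μ : Measure X) [μ.IsAddLeftInvariant] (N : AddSubgroup X) (hN : IsOpen (N : Set X)) (w : X)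
    [Decidable (w ∈ annihilator χ hχ.map_add N)] :
    ∫ y, (χ w y : ℂ) * (N : Set X).indicator 1 y ∂μ =
      if w ∈ annihilator χ hχ.map_add N then (μ.real N : ℂ) else 0 := by
  split_ifs with hw
  · have : ∀ y, (χ w y : ℂ) * (N : Set X).indicator 1 y =
        (N : Set X).indicator (fun _ => (1 : ℂ)) y := by
      intro y
      by_cases hy : y ∈ (N : Set X)
      · rw [hχ.symm, hw y hy]; simp [hy]
      · simp [hy]
    simp only [this]
    rw [MeasureTheory.integral_indicator hN.measurableSet]
    simp
  · have : ∃ l ∈ N, χ l w ≠ 1 := by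
      by_contra! h
      exact hw h
    obtain ⟨l, hl, hlw⟩ := this
    simp only [hχ.symm w]
    refine hχ.integral_eq_zero μ hlw fun x => ?_
    have h : x + l ∈ (N : Set X) ↔ x ∈ (N : Set X) := AddSubgroup.add_mem_cancel_right N hl
    by_cases hx : x ∈ (N : Set X)
    · rw [Set.indicator_of_mem hx, Set.indicator_of_mem (h.2 hx)]; rfl
    · rw [Set.indicator_of_notMem hx, Set.indicator_of_notMem (mt h.1 hx)]

/-- Fourier inversion: the square of the Fourier transform is a nonzero multiple of the reflection.
The constant is the product of the volumes of a small subgroup and of its annihilator; that it does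
not depend on the choice of the subgroup is not needed for bijectivity. -/
theorem exists_fourier_fourier [IsTopologicalAddGroup X] [T2Space X] [MeasurableSpace X]
    [BorelSpace X] (μ : Measure X) [μ.IsAddHaarMeasure] (φ : BruhatSchwartz X) :
    ∃ c : ℂ, c ≠ 0 ∧ ∀ z, (hχ.fourier μ (hχ.fourier μ φ)).1 z = c * φ.1 (-z) := by
  classical
  obtain ⟨U, hU, hinv⟩ := exists_nhds_invariant φ
  obtain ⟨L, hL, hLc, hLU, hLL⟩ := hχ.exists_subgroup U hU
  set N := annihilator χ hχ.map_add (L : Set X) with hNdef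
  have hN : IsOpen (N : Set X) := isOpen_annihilator hχ.map_add hχ.locallyConstant hLc
  have hNc : IsCompact (N : Set X) := hχ.isCompact_annihilator L hL
  have hreal : ∀ K : AddSubgroup X, IsOpen (K : Set X) → IsCompact (K : Set X) → μ.real K ≠ 0 :=
    fun K hK hKc => (ENNReal.toReal_pos (hK.measure_pos μ ⟨0, K.zero_mem⟩).ne'
      hKc.measure_lt_top.ne).ne'
  refine ⟨μ.real N * μ.real L, mul_ne_zero (by exact_mod_cast hreal N hN hNc)
    (by exact_mod_cast hreal L hL hLc), fun z => ?_⟩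
  have hsupp : ∀ y ∉ N, (hχ.fourier μ φ).1 y = 0 := fun y hy => by
    have : ∃ l ∈ L, χ l y ≠ 1 := by
      by_contra! h
      exact hy h
    obtain ⟨l, hl, hly⟩ := this
    exact hχ.integral_eq_zero μ hly (hinv l (hLU hl))
  let ind : X → ℂ := (N : Set X).indicator 1
  have hind : Continuous ind :=
    (IsClopen.continuous_indicator ⟨N.isClosed_of_isOpen hN, hN⟩ continuous_one)
  let f : X → X → ℂ := fun y x => φ.1 x * ((χ (x + z) y : ℂ) * ind y)
  have hf : Continuous f.uncurry := by
    have h1 : Continuous fun p : X × X => (χ (p.2 + z) p.1 : ℂ) :=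
      hχ.continuous_coe.comp ((continuous_snd.add_const z).prodMk continuous_fst)
    exact (φ.2.1.continuous.comp continuous_snd).mul (h1.mul (hind.comp continuous_fst))
  have hfc : HasCompactSupport f.uncurry := by
    refine HasCompactSupport.intro (hNc.prod φ.2.2.isCompact) ?_
    rintro ⟨y, x⟩ hyx
    simp only [f, Function.uncurry, ind]
    by_cases hy : y ∈ (N : Set X)
    · have hx : x ∉ tsupport φ.1 := fun hx => hyx ⟨hy, hx⟩
      rw [image_eq_zero_of_notMem_tsupport hx, zero_mul]
    · rw [Set.indicator_of_notMem hy, mul_zero, mul_zero]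
  -- `𝓕 φ` is supported in the compact set `N`; cutting off there justifies Fubini's theorem
  calc (hχ.fourier μ (hχ.fourier μ φ)).1 z
      = ∫ y, ∫ x, f y x ∂μ ∂μ := by
        rw [hχ.fourier_apply]
        refine integral_congr_ae (Filter.Eventually.of_forall fun y => ?_)
        simp only [f, ind]
        by_cases hy : y ∈ (N : Set X)
        · rw [hχ.fourier_apply, ← integral_const_mul]
          refine integral_congr_ae (Filter.Eventually.of_forall fun x => ?_)
          simp only [hχ.map_add_left, Set.indicator_of_mem hy, Circle.coe_mul, hχ.symm y z,
            Pi.one_apply]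
          ring
        · rw [hsupp y hy]
          simp [hy]
    _ = ∫ x, ∫ y, f y x ∂μ ∂μ := integral_integral_swap_of_hasCompactSupport hf hfc
    _ = ∫ x, (μ.real N * φ.1 (-z)) * (L : Set X).indicator 1 (x + z) ∂μ := by
        refine integral_congr_ae (Filter.Eventually.of_forall fun x => ?_)
        simp only [f, ind]
        rw [integral_const_mul, hχ.integral_indicator μ N hN]
        by_cases hx : x + z ∈ L
        · have h1 : x + z ∈ annihilator χ hχ.map_add N := fun y hy => by
            rw [hχ.symm]; exact hy _ hx
          have h2 := hinv (x + z) (hLU hx) (-z)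
          rw [show -z + (x + z) = x by abel] at h2
          rw [if_pos h1, h2]
          simp [hx, mul_comm]
        · have h1 : x + z ∉ annihilator χ hχ.map_add N := fun h => hx (hLL h)
          rw [if_neg h1]
          simp [hx]
    _ = μ.real N * μ.real L * φ.1 (-z) := by
        rw [integral_const_mul,
          integral_add_right_eq_self (fun x => (L : Set X).indicator (1 : X → ℂ) x) z,
          MeasureTheory.integral_indicator hL.measurableSet]
        simp
        ring

theorem fourier_bijective [IsTopologicalAddGroup X] [T2Space X] [MeasurableSpace X] [BorelSpace X]
    (μ : Measure X) [μ.IsAddHaarMeasure] : Function.Bijective (hχ.fourier μ) := by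
  constructor
  · rw [injective_iff_map_eq_zero]
    intro φ hφ
    obtain ⟨c, hc, h⟩ := hχ.exists_fourier_fourier μ φ
    ext z
    have h1 := h (-z)
    rw [hφ, map_zero, neg_neg] at h1
    simpa [hc] using h1.symm
  · intro φ
    let φ' : BruhatSchwartz X := ⟨fun x => φ.1 (-x), φ.2.1.comp_continuous continuous_neg,
      φ.2.2.comp_homeomorph (Homeomorph.neg X)⟩
    obtain ⟨c, hc, h⟩ := hχ.exists_fourier_fourier μ φ'
    refine ⟨c⁻¹ • hχ.fourier μ φ', ?_⟩
    ext z
    rw [map_smul]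
    simp only [Submodule.coe_smul, Pi.smul_apply, h, smul_eq_mul, φ', neg_neg]
    field_simp

end IsSelfDual

end SelfDual

/-! ### Self-duality of algebras over non-archimedean local fields -/

section Characters

/-- Unitary characters of an abelian group separate the elements outside a subgroup from it. -/
theorem exists_addChar_ne_one {G : Type*} [AddCommGroup G] (H : AddSubgroup G) {x : G}
    (hx : x ∉ H) : ∃ ψ : AddChar G Circle, (∀ h ∈ H, ψ h = 1) ∧ ψ x ≠ 1 := by
  have hx' : (x : G ⧸ H) ≠ 0 := by rwa [Ne, QuotientAddGroup.eq_zero_iff]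
  obtain ⟨c, hc⟩ := CharacterModule.exists_character_apply_ne_zero_of_ne_zero hx'
  -- the inclusion of `ℚ / ℤ` into `ℝ / ℤ`
  let i : AddCircle (1 : ℚ) →+ AddCircle (1 : ℝ) :=
    QuotientAddGroup.map _ _ (Rat.castHom ℝ).toAddMonoidHom (by
      rw [AddSubgroup.zmultiples_le, AddSubgroup.mem_comap]
      exact AddSubgroup.mem_zmultiples_iff.2 ⟨1, by simp⟩)
  have hi : ∀ z, i z = 0 → z = 0 := by
    intro z hz
    obtain ⟨q, rfl⟩ := QuotientAddGroup.mk_surjective z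
    have h1 : ((q : ℝ) : AddCircle (1 : ℝ)) = 0 := hz
    rw [AddCircle.coe_eq_zero_iff] at h1
    obtain ⟨n, hn⟩ := h1
    refine AddCircle.coe_eq_zero_iff _ |>.2 ⟨n, ?_⟩
    have : ((n : ℚ) : ℝ) = q := by simpa using hn
    simpa using Rat.cast_injective this
  let ψ : AddChar G Circle :=
    AddCircle.toCircle_addChar.compAddMonoidHom (i.comp (c.comp (QuotientAddGroup.mk' H)))
  have hψ : ∀ g, ψ g = AddCircle.toCircle (i (c (g : G ⧸ H))) := fun g => rfl
  refine ⟨ψ, fun h hh => ?_, fun h => hc (hi _ ?_)⟩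
  · rw [hψ, (QuotientAddGroup.eq_zero_iff h).2 hh, map_zero, map_zero, AddCircle.toCircle_zero]
  · rw [hψ, ← AddCircle.toCircle_zero (T := 1)] at h
    exact AddCircle.injective_toCircle one_ne_zero h

end Characters

section Nonarchimedean

open ValuativeRel MeasureTheory

variable (F : Type*) [Field F] [ValuativeRel F] [TopologicalSpace F] [IsNonarchimedeanLocalField F]

theorem isOpen_setOf_valuation_le_one : IsOpen {x : F | valuation F x ≤ 1} := by
  have h : IsOpen ((valuation F).integer.toAddSubgroup : Set F) := by
    refine AddSubgroup.isOpen_of_mem_nhds _ (g := 0) ?_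
    refine Filter.mem_of_superset ((IsValuativeTopology.hasBasis_nhds_zero' F).mem_of_mem
      (i := 1) one_ne_zero) fun x (hx : valuation F x < 1) => ?_
    exact (show valuation F x ≤ 1 from hx.le)
  exact h

theorem exists_ne_zero_valuation_lt {γ : ValueGroupWithZero F} (hγ : γ ≠ 0) :
    ∃ c : F, c ≠ 0 ∧ valuation F c < γ := by
  obtain ⟨r, rfl⟩ := ValuativeRel.valuation_surjective γ
  have hr : r ≠ 0 := fun h => hγ (by simp [h])
  obtain ⟨s, hs, hs1⟩ := Valuation.IsNontrivial.exists_lt_one (v := valuation F)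
  refine ⟨s * r, mul_ne_zero (by simpa using hs) hr, ?_⟩
  rw [map_mul]
  exact mul_lt_of_lt_one_left (zero_lt_iff.2 hγ) hs1

theorem infinite_of_nonarchimedean : Infinite F := by
  by_contra h
  have : Finite F := not_infinite_iff_finite.1 h
  obtain ⟨s, hs, hs1⟩ := exists_ne_zero_valuation_lt F one_ne_zero
  have hinj : Function.Injective fun k : ℕ => valuation F (s ^ k) := by
    refine (strictAnti_nat_of_succ_lt fun k => ?_).injective
    simp only [map_pow]
    exact pow_lt_pow_right_of_lt_one₀ (zero_lt_iff.2 (by simpa using hs)) hs1 (Nat.lt_succ_self k)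
  exact not_injective_infinite_finite (fun k : ℕ => s ^ k) (Function.Injective.of_comp hinj)

theorem t2Space_of_nonarchimedean : T2Space F := by
  refine IsTopologicalAddGroup.t2Space_of_zero_sep fun x hx => ?_
  have hx' : valuation F x ≠ 0 := by simpa using hx
  exact ⟨_, (IsValuativeTopology.hasBasis_nhds_zero' F).mem_of_mem hx',
    fun h => lt_irrefl (valuation F x) h⟩

/-- A nontrivial additive character which is trivial on the ring of integers. -/
theorem exists_addChar : ∃ ψ : AddChar F Circle, (∀ a, valuation F a ≤ 1 → ψ a = 1) ∧
    ∃ a, ψ a ≠ 1 := by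
  obtain ⟨s, hs, hs1⟩ := exists_ne_zero_valuation_lt F one_ne_zero
  have hs' : s⁻¹ ∉ (valuation F).integer.toAddSubgroup := by
    intro h
    have h1 : valuation F s⁻¹ ≤ 1 := h
    rw [map_inv₀] at h1
    exact not_lt_of_ge h1 ((one_lt_inv₀ (zero_lt_iff.2 (by simpa using hs))).2 hs1)
  obtain ⟨ψ, h1, h2⟩ := exists_addChar_ne_one _ hs'
  exact ⟨ψ, fun a ha => h1 a ha, _, h2⟩

variable {F}

theorem isLocallyConstant_addChar (ψ : AddChar F Circle) (hψ : ∀ a, valuation F a ≤ 1 → ψ a = 1) :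
    IsLocallyConstant ψ := by
  refine (IsLocallyConstant.iff_eventually_eq _).2 fun a => ?_
  have : (fun b => b - a) ⁻¹' {x : F | valuation F x ≤ 1} ∈ nhds a :=
    ((isOpen_setOf_valuation_le_one F).preimage (continuous_sub_right a)).mem_nhds (by simp)
  filter_upwards [this] with b hb
  have h := ψ.map_add_eq_mul (b - a) a
  rwa [sub_add_cancel, hψ _ hb, one_mul] at h

/-- The identification of a finite dimensional space with its module topology with a space of
coordinates. -/
def coordinates {F X : Type*} [Field F] [TopologicalSpace F] [IsTopologicalRing F] [AddCommGroup X]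
    [Module F X] [FiniteDimensional F X] [TopologicalSpace X] [IsTopologicalAddGroup X]
    [IsModuleTopology F X] (e : X ≃ₗ[F] (Fin (Module.finrank F X) → F)) :
    X ≃L[F] (Fin (Module.finrank F X) → F) :=
  { e with
    continuous_toFun := IsModuleTopology.continuous_of_linearMap e.toLinearMap
    continuous_invFun := IsModuleTopology.continuous_of_linearMap e.symm.toLinearMap }

/-- A finite dimensional algebra over a non-archimedean local field is self-dual through a
nontrivial additive character of the field and a nondegenerate trace form. -/
theorem isSelfDual_trace_form {A : Type*} [Ring A] [Algebra F A] [FiniteDimensional F A]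
    [TopologicalSpace A] [IsTopologicalRing A] [IsModuleTopology F A]
    (t : A →ₗ[F] F) (ht : ∀ x y, t (x * y) = t (y * x)) (hnd : ∀ x, (∀ y, t (x * y) = 0) → x = 0)
    (ψ : AddChar F Circle) (hψ : ∀ a, valuation F a ≤ 1 → ψ a = 1) (hψ1 : ∃ a, ψ a ≠ 1) :
    IsSelfDual fun x y : A => ψ (t (x * y)) := by
  have htc : Continuous t := IsModuleTopology.continuous_of_linearMap t
  have hsymm : ∀ x y : A, ψ (t (x * y)) = ψ (t (y * x)) := fun x y => by rw [ht]
  have hadd : ∀ x y z : A, ψ (t (x * (y + z))) = ψ (t (x * y)) * ψ (t (x * z)) := fun x y z => by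
    rw [mul_add, map_add, ψ.map_add_eq_mul]
  have hloc : IsLocallyConstant fun p : A × A => ψ (t (p.1 * p.2)) :=
    (isLocallyConstant_addChar ψ hψ).comp_continuous (htc.comp continuous_mul)
  obtain ⟨a₀, ha₀⟩ := hψ1
  let b := Module.finBasis F A
  let Λ : A →ₗ[F] (Fin (Module.finrank F A) → F) :=
    LinearMap.pi fun i => t.comp (LinearMap.mulLeft F (b i))
  have hΛ : ∀ y i, Λ y i = t (b i * y) := fun y i => rfl
  have hΛinj : Function.Injective Λ := by
    rw [injective_iff_map_eq_zero]
    intro y hy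
    refine hnd y fun x => ?_
    have : t.comp (LinearMap.mulLeft F y) = 0 := b.ext fun i => by
      rw [LinearMap.comp_apply, LinearMap.mulLeft_apply, ht, ← hΛ, hy]; rfl
    exact LinearMap.congr_fun this x
  let Λe := coordinates (LinearEquiv.ofInjectiveOfFinrankEq Λ hΛinj (by simp))
  have hΛe : ∀ y i, Λe y i = t (b i * y) := fun y i => rfl
  let B := coordinates b.equivFun
  have hcompact : ∀ K : AddSubgroup A, IsOpen (K : Set A) →
      IsCompact (annihilator (fun x y : A => ψ (t (x * y))) hadd K : Set A) := by
    intro K hK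
    have hclosed : IsClosed (annihilator (fun x y : A => ψ (t (x * y))) hadd K : Set A) := by
      have : (annihilator (fun x y : A => ψ (t (x * y))) hadd K : Set A) =
          ⋂ x ∈ K, {y | ψ (t (x * y)) = 1} := by
        ext y; simp [annihilator]
      rw [this]
      exact isClosed_biInter fun x _ =>
        (hloc.comp_continuous (Continuous.prodMk_right x)).isClosed_fiber 1
    have hγ : ∀ i, ∃ γ : ValueGroupWithZero F, γ ≠ 0 ∧ ∀ s, valuation F s < γ → s • b i ∈ K := by
      intro i
      have : (fun s : F => s • b i) ⁻¹' K ∈ nhds 0 :=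
        (hK.preimage (continuous_id.smul continuous_const)).mem_nhds (by simp [zero_mem])
      obtain ⟨γ, hγ, h⟩ := (IsValuativeTopology.hasBasis_nhds_zero' F).mem_iff.1 this
      exact ⟨γ, hγ, fun s hs => h hs⟩
    choose γ hγ0 hγ using hγ
    refine IsCompact.of_isClosed_subset (Λe.toHomeomorph.isCompact_preimage.2 (isCompact_univ_pi
      fun i => IsNonarchimedeanLocalField.isCompact_closedBall F (valuation F a₀ / γ i))) hclosed ?_
    intro y hy
    rw [Set.mem_preimage, Set.mem_univ_pi]
    intro i
    change valuation F (t (b i * y)) ≤ _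
    by_contra! hlt
    set a := t (b i * y) with ha
    have ha0 : a ≠ 0 := fun h => by simp [h] at hlt
    have hva : 0 < valuation F a := zero_lt_iff.2 (by simpa using ha0)
    have h1 : valuation F (a₀ / a) < γ i := by
      rw [map_div₀, div_lt_iff₀ hva, mul_comm]
      rwa [div_lt_iff₀ (zero_lt_iff.2 (hγ0 i))] at hlt
    have h2 := hy _ (hγ i _ h1)
    simp only [smul_mul_assoc, map_smul, ← ha, smul_eq_mul, div_mul_cancel₀ _ ha0] at h2
    exact ha₀ h2
  refine ⟨hadd, hsymm, hloc, hcompact, fun U hU => ?_⟩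
  -- the lattice spanned by the basis over the ring of integers, and its homothets
  let M : F → AddSubgroup A := fun c =>
    { carrier := {x | ∀ i, valuation F (B (c • x) i) ≤ 1}
      add_mem' := fun hx hy i => by
        rw [smul_add, map_add]
        exact (valuation F).map_add_le (hx i) (hy i)
      zero_mem' := fun i => by simp
      neg_mem' := fun hx i => by
        rw [smul_neg, map_neg, Pi.neg_apply, Valuation.map_neg]
        exact hx i }
  have hM : ∀ c, (M c : Set A) = (fun x => c • x) ⁻¹' (B ⁻¹'
      Set.univ.pi fun _ => {s : F | valuation F s ≤ 1}) := fun c => by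
    ext x
    simp only [Set.mem_preimage, Set.mem_univ_pi]
    rfl
  have hMopen : ∀ c, IsOpen (M c : Set A) := fun c => by
    rw [hM]
    exact ((isOpen_set_pi Set.finite_univ fun _ _ => isOpen_setOf_valuation_le_one F).preimage
      B.continuous).preimage (continuous_const_smul c)
  have hMcomp : ∀ c, c ≠ 0 → IsCompact (M c : Set A) := fun c hc => by
    rw [hM]
    exact (Homeomorph.smulOfNeZero c hc).isCompact_preimage.2 (B.toHomeomorph.isCompact_preimage.2
      (isCompact_univ_pi fun i => IsNonarchimedeanLocalField.isCompact_closedBall F 1))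
  obtain ⟨U', hU', hU'o, h0U'⟩ := mem_nhds_iff.1 hU
  obtain ⟨W, V, hW, -, h0W, hV, hWV⟩ := generalized_tube_lemma (isCompact_singleton (x := (0 : F)))
    (hcompact (M 1) (hMopen 1)) (hU'o.preimage (continuous_smul (M := F) (X := A))) (by
      rintro ⟨c, x⟩ ⟨hc, -⟩
      rw [Set.mem_singleton_iff] at hc
      simp only at hc
      simpa [hc])
  obtain ⟨γ, hγ, hγW⟩ := (IsValuativeTopology.hasBasis_nhds_zero' F).mem_iff.1
    (hW.mem_nhds (h0W rfl))
  obtain ⟨c, hc, hcγ⟩ := exists_ne_zero_valuation_lt F hγ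
  refine ⟨annihilator _ hadd (M c), isOpen_annihilator hadd hloc (hMcomp c hc),
    hcompact _ (hMopen c), fun y hy => hU' ?_, fun y hy x hx => hy x fun z hz => ?_⟩
  · have h1 : c⁻¹ • y ∈ annihilator (fun x y : A => ψ (t (x * y))) hadd (M 1) := by
      intro x hx
      have hx' : c⁻¹ • x ∈ M c := fun i => by
        rw [smul_inv_smul₀ hc]
        simpa using hx i
      have := hy _ hx'
      simpa using this
    have h2 := hWV (a := (c, c⁻¹ • y)) ⟨hγW hcγ, hV h1⟩
    simpa [smul_inv_smul₀ hc] using h2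
  · simp only
    rw [ht]
    exact hz x hx

end Nonarchimedean

/-! ### The Fourier transform on `M_n(D)` -/

section FourierTransforms

open MeasureTheory

/-- Precomposition with a linear automorphism, as an isomorphism of Schwartz spaces. -/
def schwartzCompEquiv {E E' : Type*} [NormedAddCommGroup E] [NormedSpace ℝ E]
    [NormedAddCommGroup E'] [NormedSpace ℝ E'] (e : E ≃L[ℝ] E') :
    SchwartzMap E' ℂ ≃L[ℂ] SchwartzMap E ℂ :=
  ContinuousLinearEquiv.equivOfInverse (SchwartzMap.compCLMOfContinuousLinearEquiv ℂ e)
    (SchwartzMap.compCLMOfContinuousLinearEquiv ℂ e.symm)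
    (fun φ => SchwartzMap.ext fun x => by simp) (fun φ => SchwartzMap.ext fun x => by simp)

section

variable {F : Type*} [Field F] [TopologicalSpace F] [IsTopologicalRing F] [LocallyCompactSpace F]
  [T2Space F] [Infinite F] {D : Type*} [DivisionRing D] [Algebra F D] [FiniteDimensional F D]
  [Algebra.IsCentral F D] [TopologicalSpace D] [IsTopologicalRing D] [IsModuleTopology F D]

/-- Fourier integrals attached to a trace form on `M_n(D)` intertwine the action of `(g, h)` with
that of `(h, g)`. -/
theorem integral_detFactor_smul {n d : ℕ} (hn : 1 ≤ n) (hd : Module.finrank F D = d ^ 2)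
    [MeasurableSpace (Matrix (Fin n) (Fin n) D)] [BorelSpace (Matrix (Fin n) (Fin n) D)]
    (μ : Measure (Matrix (Fin n) (Fin n) D)) [μ.IsAddHaarMeasure] [μ.Regular]
    (t : Matrix (Fin n) (Fin n) D →ₗ[F] F) (ht : ∀ x y, t (x * y) = t (y * x))
    (ψ : F → ℂ) (φ : Matrix (Fin n) (Fin n) D → ℂ) (g h : GLn n D)
    (y : Matrix (Fin n) (Fin n) D) :
    ∫ x, ψ (t (x * y)) *
        (((detFactor F d g h : ℝ) : ℂ) * φ ((g⁻¹ : GLn n D) * x * h)) ∂μ =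
      ((detFactor F d h g : ℝ) : ℂ) * ∫ x, ψ (t (x * ((h⁻¹ : GLn n D) * y * g))) * φ x ∂μ := by
  have : Nonempty (Fin n) := ⟨⟨0, hn⟩⟩
  have : IsModuleTopology F (Matrix (Fin n) (Fin n) D) :=
    inferInstanceAs (IsModuleTopology F (Fin n → Fin n → D))
  have h1 := integral_pairing_comp_mul_mul (F := F) μ t ht ψ φ g h y
  have h2 : 0 < normalizedAbs (Algebra.norm F
      ((g⁻¹ * h : GLn n D) : Matrix (Fin n) (Fin n) D)) :=
    normalizedAbs_pos (((g⁻¹ * h).isUnit.map (Algebra.norm F)).ne_zero)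
  calc _ = ((detFactor F d g h : ℝ) : ℂ) *
        ∫ x, ψ (t (x * y)) * φ ((g⁻¹ : GLn n D) * x * h) ∂μ := by
        rw [← integral_const_mul]
        exact integral_congr_ae (Filter.Eventually.of_forall fun x => by simp only; ring)
    _ = _ := by
        rw [h1, detFactor_eq_mul_swap hn hd, ← mul_assoc]
        congr 1
        rw [← Complex.ofReal_mul, mul_right_comm, mul_inv_cancel₀ h2.ne', one_mul]

end

/-- The Fourier transform on Bruhat-Schwartz functions on `M_n(D)` exchanges the two actions of
`GL_n(D)`. -/
theorem exists_bruhatSchwartz_fourier (F : Type*) [Field F] [ValuativeRel F] [TopologicalSpace F]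
    [IsNonarchimedeanLocalField F] {D : Type*} [DivisionRing D] [Algebra F D]
    [FiniteDimensional F D] [Algebra.IsCentral F D] [TopologicalSpace D] [IsTopologicalRing D]
    [IsModuleTopology F D] {n d : ℕ} (hn : 1 ≤ n) (hd : Module.finrank F D = d ^ 2) :
    ∃ 𝓕 : BruhatSchwartz (Matrix (Fin n) (Fin n) D) ≃ₗ[ℂ]
        BruhatSchwartz (Matrix (Fin n) (Fin n) D),
      ∀ (g h : GLn n D) φ, 𝓕 (bsAct F d g h φ) = bsAct F d h g (𝓕 φ) := by
  have : Nonempty (Fin n) := ⟨⟨0, hn⟩⟩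
  have : IsModuleTopology F (Matrix (Fin n) (Fin n) D) :=
    inferInstanceAs (IsModuleTopology F (Fin n → Fin n → D))
  have := infinite_of_nonarchimedean F
  have := t2Space_of_nonarchimedean F
  let B := coordinates (Module.finBasis F (Matrix (Fin n) (Fin n) D)).equivFun
  have : T2Space (Matrix (Fin n) (Fin n) D) := B.toHomeomorph.symm.t2Space
  have : LocallyCompactSpace (Matrix (Fin n) (Fin n) D) :=
    B.toHomeomorph.isClosedEmbedding.locallyCompactSpace
  let _ : MeasurableSpace (Matrix (Fin n) (Fin n) D) := borel _
  have : BorelSpace (Matrix (Fin n) (Fin n) D) := ⟨rfl⟩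
  obtain ⟨t, ht, hnd⟩ := exists_nondegenerate_trace_form (F := F) (A := Matrix (Fin n) (Fin n) D)
  obtain ⟨ψ, hψ, hψ1⟩ := exists_addChar F
  have hχ := isSelfDual_trace_form t ht hnd ψ hψ hψ1
  refine ⟨LinearEquiv.ofBijective (hχ.fourier Measure.addHaar) (hχ.fourier_bijective _),
    fun g h φ => ?_⟩
  ext y
  exact integral_detFactor_smul hn hd Measure.addHaar t ht (fun a => (ψ a : ℂ)) φ.1 g h y

attribute [local instance] Matrix.normedAddCommGroup Matrix.normedSpace

/-- The Fourier transform on Schwartz functions on `M_n(D)` exchanges the two actions of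
`GL_n(D)`. -/
theorem exists_schwartz_fourier (F : Type*) [RCLike F] {D : Type*} [NormedDivisionRing D]
    [NormedAlgebra ℝ D] [NormedAlgebra F D] [IsScalarTower ℝ F D] [FiniteDimensional F D]
    [Algebra.IsCentral F D] {n d : ℕ} (hn : 1 ≤ n) (hd : Module.finrank F D = d ^ 2) :
    ∃ 𝓕 : MatrixSchwartz D n ≃L[ℂ] MatrixSchwartz D n,
      ∀ (g h : GLn n D) φ, 𝓕 (schwartzAct F d g h φ) = schwartzAct F d h g (𝓕 φ) := by
  have : Nonempty (Fin n) := ⟨⟨0, hn⟩⟩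
  have : IsModuleTopology F D := isModuleTopologyOfFiniteDimensional
  have : FiniteDimensional ℝ D := FiniteDimensional.trans ℝ F D
  have : Infinite F := Infinite.of_injective (algebraMap ℝ F) (algebraMap ℝ F).injective
  let A := Matrix (Fin n) (Fin n) D
  let _ : MeasurableSpace A := borel _
  have : BorelSpace A := ⟨rfl⟩
  obtain ⟨t, ht, hnd⟩ := exists_nondegenerate_trace_form (F := F) (A := A)
  let E := EuclideanSpace ℝ (Fin (Module.finrank ℝ A))
  let T : A ≃L[ℝ] E := ContinuousLinearEquiv.ofFinrankEq (by simp [E])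
  -- the real pairing `re (t (x y))`
  let b : A →ₗ[ℝ] A →ₗ[ℝ] ℝ := (LinearMap.mul ℝ A).compr₂
    (RCLike.reLm.comp (t.restrictScalars ℝ))
  -- the Riesz map of this pairing, transported to the Euclidean space `E`
  let J₀ : A →ₗ[ℝ] E := (InnerProductSpace.toDual ℝ E).symm.toLinearEquiv.toLinearMap ∘ₗ
    LinearMap.toContinuousLinearMap.toLinearMap ∘ₗ
      (LinearMap.lcomp ℝ ℝ T.symm.toLinearEquiv.toLinearMap) ∘ₗ b.flip
  have hJ₀ : ∀ v y, inner ℝ v (J₀ y) = RCLike.re (t (T.symm v * y)) := by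
    intro v y
    rw [real_inner_comm]
    exact InnerProductSpace.toDual_symm_apply
  have hJinj : Function.Injective J₀ := by
    rw [injective_iff_map_eq_zero]
    intro y hy
    refine hnd y fun x => ?_
    have hre : ∀ x, RCLike.re (t (x * y)) = 0 := fun x => by
      have := hJ₀ (T x) y
      rw [hy, inner_zero_right, T.symm_apply_apply] at this
      exact this.symm
    -- `re` loses nothing: rescaling `x` by `conj (t (x y))` makes the value `|t (x y)| ^ 2`
    have h1 := hre ((starRingEnd F) (t (x * y)) • x)
    rw [smul_mul_assoc, map_smul, smul_eq_mul, RCLike.conj_mul] at h1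
    rw [ht]
    have h2 : ‖t (x * y)‖ ^ 2 = 0 := by exact_mod_cast h1
    simpa using h2
  let J : A ≃L[ℝ] E :=
    (LinearEquiv.ofInjectiveOfFinrankEq J₀ hJinj (by simp [E])).toContinuousLinearEquiv
  let 𝓕 : MatrixSchwartz D n ≃L[ℂ] MatrixSchwartz D n :=
    ((schwartzCompEquiv T.symm).trans (FourierTransform.fourierCLE ℂ (SchwartzMap E ℂ))).trans
      (schwartzCompEquiv J)
  let μ : Measure A := (volume : Measure E).map T.symm
  have hμ : μ.IsAddHaarMeasure := T.symm.isAddHaarMeasure_map volume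
  have hreg : μ.Regular := Measure.Regular.map T.symm.toHomeomorph
  let ψ : F → ℂ := fun a => (Real.fourierChar (-RCLike.re a) : ℂ)
  have h𝓕 : ∀ φ y, 𝓕 φ y = ∫ x, ψ (t (x * y)) * φ x ∂μ := by
    intro φ y
    have h1 : 𝓕 φ y = FourierTransform.fourier (fun v => φ (T.symm v)) (J y) := rfl
    have h2 := integral_map_equiv (μ := (volume : Measure E)) T.symm.toHomeomorph.toMeasurableEquiv
      (fun x => ψ (t (x * y)) * φ x)
    refine Eq.trans ?_ h2.symm
    rw [h1, Real.fourier_eq]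
    refine integral_congr_ae (Filter.Eventually.of_forall fun v => ?_)
    have h3 : inner ℝ v (J y) = RCLike.re (t (T.symm v * y)) := hJ₀ v y
    simp only [h3, Circle.smul_def, smul_eq_mul]
    rfl
  refine ⟨𝓕, fun g h φ => SchwartzMap.ext fun y => ?_⟩
  rw [h𝓕, schwartzAct_apply, h𝓕]
  exact integral_detFactor_smul hn hd μ t ht ψ φ g h y

end FourierTransforms

/-! ### Coinvariants and completed tensor products -/

section Transport

theorem coinvariantsKer_map {G W : Type*} [AddCommGroup W] [Module ℂ W] {T T' : G → W →ₗ[ℂ] W}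
    (E : W ≃ₗ[ℂ] W) (hE : ∀ g x, E (T g x) = T' g (E x)) :
    (coinvariantsKer T).map (E : W →ₗ[ℂ] W) = coinvariantsKer T' := by
  rw [coinvariantsKer, coinvariantsKer, Submodule.map_span]
  congr 1
  ext y
  constructor
  · rintro ⟨_, ⟨g, x, rfl⟩, rfl⟩
    exact ⟨g, E x, by rw [LinearEquiv.coe_coe, map_sub, hE]⟩
  · rintro ⟨g, x, rfl⟩
    refine ⟨_, ⟨g, E.symm x, rfl⟩, ?_⟩
    rw [LinearEquiv.coe_coe, map_sub, hE, E.apply_symm_apply]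

variable {G W : Type*} [AddCommGroup W] [Module ℂ W] [TopologicalSpace W]
  [IsTopologicalAddGroup W] [ContinuousConstSMul ℂ W]

theorem closedCoinvariantsKer_le_comap_of_intertwines {T T' : G → W →L[ℂ] W} (E : W →L[ℂ] W)
    (hE : ∀ g x, E (T g x) = T' g (E x)) :
    closedCoinvariantsKer T ≤ (closedCoinvariantsKer T').comap E.toLinearMap := by
  refine Submodule.topologicalClosure_minimal _ ?_
    ((Submodule.isClosed_topologicalClosure _).preimage E.continuous)
  refine Submodule.span_le.2 ?_
  rintro _ ⟨g, x, rfl⟩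
  refine Submodule.le_topologicalClosure _ (Submodule.subset_span ⟨g, E x, ?_⟩)
  rw [ContinuousLinearMap.coe_coe, map_sub]
  exact congrArg (· - E x) (hE g x)

/-- An automorphism intertwining two families of operators induces an isomorphism of their Hausdorff
coinvariants. -/
def hausdorffCoinvariantsEquiv {T T' : G → W →L[ℂ] W} (E : W ≃L[ℂ] W)
    (hE : ∀ g x, E (T g x) = T' g (E x)) :
    HausdorffCoinvariants T ≃L[ℂ] HausdorffCoinvariants T' :=
  have hE' : ∀ g x, E.symm (T' g x) = T g (E.symm x) := fun g x => by
    rw [E.symm_apply_eq, hE, E.apply_symm_apply]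
  have h₁ := closedCoinvariantsKer_le_comap_of_intertwines (E : W →L[ℂ] W) hE
  have h₂ := closedCoinvariantsKer_le_comap_of_intertwines (E.symm : W →L[ℂ] W) hE'
  { toLinearMap := Submodule.mapQ _ _ (E : W →L[ℂ] W).toLinearMap h₁
    invFun := Submodule.mapQ _ _ (E.symm : W →L[ℂ] W).toLinearMap h₂
    left_inv := fun x => by
      obtain ⟨x, rfl⟩ := Submodule.mkQ_surjective _ x
      exact congrArg _ (E.symm_apply_apply x)
    right_inv := fun x => by
      obtain ⟨x, rfl⟩ := Submodule.mkQ_surjective _ x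
      exact congrArg _ (E.apply_symm_apply x)
    continuous_toFun := by
      refine (Submodule.isOpenQuotientMap_mkQ _).isQuotientMap.continuous_iff.2 ?_
      exact (Submodule.isOpenQuotientMap_mkQ _).continuous.comp E.continuous
    continuous_invFun := by
      refine (Submodule.isOpenQuotientMap_mkQ _).isQuotientMap.continuous_iff.2 ?_
      exact (Submodule.isOpenQuotientMap_mkQ _).continuous.comp E.symm.continuous }

end Transport

section Completed

variable {E : Type*} [AddCommGroup E] [Module ℂ E] [TopologicalSpace E]
  {H : Type*} [AddCommGroup H] [Module ℂ H] [TopologicalSpace H]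

theorem completedMap_completedMap (A A' : E →L[ℂ] E) (B B' : H →L[ℂ] H) (z : CompletedTensor E H) :
    completedMap A B (completedMap A' B' z) = completedMap (A.comp A') (B.comp B') z := by
  induction z using UniformSpace.Completion.induction_on with
  | hp =>
    exact isClosed_eq ((completedMap A B).continuous.comp (completedMap A' B').continuous)
      (completedMap _ _).continuous
  | ih z =>
    simp only [completedMap, ContinuousLinearMap.completion_apply_coe]
    congr 1
    change TensorProduct.map A.toLinearMap B.toLinearMap
        (TensorProduct.map A'.toLinearMap B'.toLinearMap z) =
      TensorProduct.map (A.comp A').toLinearMap (B.comp B').toLinearMap z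
    induction z using TensorProduct.induction_on with
    | zero => simp
    | add x y hx hy => simp only [map_add, hx, hy]
    | tmul x y => simp

theorem completedMap_id (z : CompletedTensor E H) :
    completedMap (ContinuousLinearMap.id ℂ E) (ContinuousLinearMap.id ℂ H) z = z := by
  induction z using UniformSpace.Completion.induction_on with
  | hp => exact isClosed_eq (completedMap _ _).continuous continuous_id
  | ih z =>
    simp only [completedMap, ContinuousLinearMap.completion_apply_coe]
    congr 1
    exact congrArg (fun f : E ⊗[ℂ] H →ₗ[ℂ] E ⊗[ℂ] H => f z) TensorProduct.map_id

variable (H) in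
/-- The automorphism `A ⊗̂ id` of a completed tensor product. -/
def completedEquiv (A : E ≃L[ℂ] E) : CompletedTensor E H ≃L[ℂ] CompletedTensor E H :=
  ContinuousLinearEquiv.equivOfInverse
    (completedMap (A : E →L[ℂ] E) (ContinuousLinearMap.id ℂ H))
    (completedMap (A.symm : E →L[ℂ] E) (ContinuousLinearMap.id ℂ H))
    (fun z => by
      rw [completedMap_completedMap]
      simpa using completedMap_id z)
    (fun z => by
      rw [completedMap_completedMap]
      simpa using completedMap_id z)

theorem completedEquiv_completedMap (A : E ≃L[ℂ] E) {S S' : E →L[ℂ] E}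
    (h : ∀ x, A (S x) = S' (A x)) (B : H →L[ℂ] H) (z : CompletedTensor E H) :
    completedEquiv H A (completedMap S B z) = completedMap S' B (completedEquiv H A z) := by
  change completedMap _ _ (completedMap _ _ z) = completedMap _ _ (completedMap _ _ z)
  rw [completedMap_completedMap, completedMap_completedMap]
  congr 2
  exact ContinuousLinearMap.ext h

end Completed

end FullTheta

end

theorem proposition1p4 (n : ℕ) (hn : 1 ≤ n) (d : ℕ) :
    -- non-archimedean local fields `F`
    (∀ (F : Type*) [Field F] [ValuativeRel F] [TopologicalSpace F] [IsNonarchimedeanLocalField F]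
      (D : Type*) [DivisionRing D] [Algebra F D] [FiniteDimensional F D] [Algebra.IsCentral F D]
      [TopologicalSpace D] [IsTopologicalRing D] [IsModuleTopology F D]
      (_ : Module.finrank F D = d ^ 2)
      (V : Type*) [AddCommGroup V] [Module ℂ V]
      (σ : Representation ℂ (FullTheta.GLn n D) V),
      FullTheta.IsAdmissibleSmooth σ → σ.IsIrreducible →
      ∃ e : FullTheta.Theta₁ F d σ ≃ₗ[ℂ] FullTheta.Theta₂ F d σ,
        ∀ g x, e (FullTheta.theta₁Act F d σ g x) = FullTheta.theta₂Act F d σ g (e x)) ∧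
    -- archimedean local fields `F`, that is, `ℝ` and `ℂ`
    (∀ (F : Type*) [RCLike F]
      (D : Type*) [NormedDivisionRing D] [NormedAlgebra ℝ D] [NormedAlgebra F D]
      [IsScalarTower ℝ F D] [FiniteDimensional F D] [Algebra.IsCentral F D]
      (_ : Module.finrank F D = d ^ 2)
      (V : Type*) [AddCommGroup V] [Module ℂ V] [UniformSpace V]
      (σ : Representation ℂ (FullTheta.GLn n D) V),
      FullTheta.IsCasselmanWallach σ → FullTheta.IsTopIrreducible σ →
      ∀ (W : Type*) [AddCommGroup W] [Module ℂ W] [UniformSpace W]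
        (τ : Representation ℂ (FullTheta.GLn n D) W) (hτ : FullTheta.IsContragredient σ τ),
      ∃ e : FullTheta.ArchTheta₁ F d τ hτ.casselmanWallach.continuous_apply ≃L[ℂ]
          FullTheta.ArchTheta₂ F d τ hτ.casselmanWallach.continuous_apply,
        ∀ g x, e (FullTheta.archTheta₁Act F d τ hτ.casselmanWallach.continuous_apply g x) =
          FullTheta.archTheta₂Act F d τ hτ.casselmanWallach.continuous_apply g (e x)) := by
  refine ⟨fun F _ _ _ _ D _ _ _ _ _ _ _ hd V _ _ σ _ _ => ?_,
    fun F _ D _ _ _ _ _ _ hd V _ _ _ σ _ _ W _ _ _ τ hτ => ?_⟩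
  · obtain ⟨𝓕, h𝓕⟩ := FullTheta.exists_bruhatSchwartz_fourier F (D := D) hn hd
    let E : FullTheta.BSTensor σ ≃ₗ[ℂ] FullTheta.BSTensor σ :=
      TensorProduct.congr 𝓕 (LinearEquiv.refl ℂ _)
    have hE : ∀ (g h : FullTheta.GLn n D)
        (B : (FullTheta.smoothDual σ).toSubmodule →ₗ[ℂ] (FullTheta.smoothDual σ).toSubmodule)
        (x : FullTheta.BSTensor σ), E (TensorProduct.map (FullTheta.bsAct F d g h) B x) =
          TensorProduct.map (FullTheta.bsAct F d h g) B (E x) := by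
      intro g h B x
      induction x using TensorProduct.induction_on with
      | zero => simp
      | add x y hx hy => simp only [map_add, hx, hy]
      | tmul φ l => simp [E, h𝓕]
    refine ⟨Submodule.Quotient.equiv _ _ E (FullTheta.coinvariantsKer_map E
      fun g x => hE g 1 (FullTheta.contragredient σ g) x), fun g x => ?_⟩
    obtain ⟨x, rfl⟩ := Submodule.mkQ_surjective _ x
    exact congrArg Submodule.Quotient.mk (hE 1 g LinearMap.id x)
  · obtain ⟨𝓕, h𝓕⟩ := FullTheta.exists_schwartz_fourier F (D := D) hn hd
    have hτ' := hτ.casselmanWallach.continuous_apply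
    refine ⟨FullTheta.hausdorffCoinvariantsEquiv (FullTheta.completedEquiv W 𝓕)
      fun g x => FullTheta.completedEquiv_completedMap 𝓕 (h𝓕 g 1) ⟨τ g, hτ' g⟩ x, fun g x => ?_⟩
    obtain ⟨x, rfl⟩ := Submodule.mkQ_surjective _ x
    exact congrArg Submodule.Quotient.mk
      (FullTheta.completedEquiv_completedMap 𝓕 (h𝓕 1 g) (ContinuousLinearMap.id ℂ W) x)
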